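/- For $\mu,\lambda>0$ the inverse Gaussian distribution has density $\sqrt{\lambda/(2\pi x^3)}\,\exp\!\big(-\lambda(x-\mu)^2/(2\mu^2x)\big)$ on $(0,\infty)$. Its $r$-th cumulant (the $r$-th derivative at $0$ of $t\mapsto\log\mathbb{E}(e^{tX})$) is $$\kappa_r(\mu,\lambda)=\frac{(2r-3)!!\,\mu^{2r-1}}{\lambda^{r-1}}\qquad(r\ge 1,\ (-1)!!=1).$$ Let $d\ge 2$ and let $\mathcal{K}_d^{\mathrm{IG}}\subseteq\mathbb{C}^d$ be the Zariski closure of the image of $\mathbb{C}\times\mathbb{C}^*\to\mathbb{C}^d$, $(\mu,\lambda)\mapsto(\kappa_1(\mu,\lambda),\dots,\kappa_d(\mu,\lambda))$. Let $\mathcal{I}(\mathcal{K}_d^{\mathrm{IG}})\subseteq\mathbb{C}[\kappa_1,\dots,\kappa_d]$ be its vanishing ideal and $$K_d=\begin{pmatrix}\kappa_1&3\kappa_2&5\kappa_3&\cdots&(2d-3)\kappa_{d-1}\\ \kappa_2&\kappa_3&\kappa_4&\cdots&\kappa_d\end{pmatrix}.$$ Then: 1. $\mathcal{I}(\mathcal{K}_d^{\mathrm{IG}})$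 is prime and is generated by the 2-minors of $K_d$, which are $\binom{d-1}{2}$ distinct nonzero quadrics. 2. $\mathbb{C}[\kappa_1,\dots,\kappa_d]/\mathcal{I}(\mathcal{K}_d^{\mathrm{IG}})$ is a Cohen–Macaulay ring, and the homogeneous ideal $\mathcal{I}(\mathcal{K}_d^{\mathrm{IG}})$ has degree $d-1$ (that is, $n!$ times the leading coefficient of the Hilbert polynomial of the quotient, $n$ being the degree of that polynomial). 3. The 2-minors of $K_d$ form a Gröbner basis of $\mathcal{I}(\mathcal{K}_d^{\mathrm{IG}})$ with respect to every antidiagonal term order, i.e. every term order for which the leading monomial of each minor of $K_d$ is that of the product of its antidiagonal entries. 4. $\mathcal{K}_d^{\mathrm{IG}}$ is the affine cone over the scaled rational normal curve $\{[c_0s^{d-1}:c_1s^{d-2}t:\cdots:c_{d-1}t^{d-1}] : [s:t]\in\mathbb{P}^1\}\subseteq\mathbb{P}^{d-1}$ with $c_i=(2i-1)!!$. -/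

import Mathlib

open MvPolynomial MeasureTheory ProbabilityTheory Filter
open scoped Nat LinearAlgebra.Projectivization

universe u

noncomputable section

/-! ### The inverse Gaussian distribution and its cumulants -/

/-- Density of the inverse Gaussian distribution with mean `μ` and shape parameter `lam`. -/
def inverseGaussianPDF (μ lam x : ℝ) : ℝ :=
  if 0 < x then
    Real.sqrt (lam / (2 * Real.pi * x ^ 3)) *
      Real.exp (-(lam * (x - μ) ^ 2 / (2 * μ ^ 2 * x)))
  else 0

/-- The inverse Gaussian distribution (for `0 < μ` and `0 < lam`). -/
def inverseGaussian (μ lam : ℝ) : Measure ℝ :=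
  (volume : Measure ℝ).withDensity fun x => ENNReal.ofReal (inverseGaussianPDF μ lam x)

/-- The `r`-th cumulant of a distribution `ν` on `ℝ`: the `r`-th derivative at `0` of the cumulant
generating function `t ↦ log ∫ exp (t * x) ∂ν`. -/
def cumulant (ν : Measure ℝ) (r : ℕ) : ℝ :=
  iteratedDeriv r (cgf (id : ℝ → ℝ) ν) 0

/-- The rational functions `(2r-3)!! μ^(2r-1) / lam^(r-1)` (for `r ≥ 1`, with `(-1)!! = 1`)
giving the cumulants of the inverse Gaussian distribution, at complex parameters.
For `r = 1` the truncated subtraction gives `0‼ = 1`, the right value. -/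
def igCumulant (μ lam : ℂ) (r : ℕ) : ℂ :=
  ((2 * r - 3)‼ : ℂ) * μ ^ (2 * r - 1) / lam ^ (r - 1)

/-- Zariski closure of a subset of affine space. -/
def zariskiClosure {σ : Type*} (V : Set (σ → ℂ)) : Set (σ → ℂ) :=
  zeroLocus ℂ (vanishingIdeal ℂ V)

/-- The `d`-th inverse Gaussian cumulant variety in `ℂ^d`: the Zariski closure of the image of
`(μ, lam) ↦ (κ_1, …, κ_d)`. The coordinate with index `i : Fin d` is `κ_(i+1)`. -/
def igCumulantVariety (d : ℕ) : Set (Fin d → ℂ) :=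
  zariskiClosure {x | ∃ μ lam : ℂ, lam ≠ 0 ∧ ∀ i : Fin d, x i = igCumulant μ lam (i + 1)}

/-! ### The matrix and its minors -/

/-- The `2 × (d-1)` matrix with top row `(2j-1) κ_j` and bottom row `κ_(j+1)`, `1 ≤ j ≤ d-1`. -/
def igCumulantMatrix (d : ℕ) : Matrix (Fin 2) (Fin (d - 1)) (MvPolynomial (Fin d) ℂ) :=
  Matrix.of ![fun j => C (2 * (j : ℂ) + 1) * X ⟨j, by omega⟩,
    fun j => X ⟨j + 1, by omega⟩]

/-- The set of `t`-minors of a matrix. -/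
def minors {R : Type*} [CommRing R] {k l : ℕ} (t : ℕ) (M : Matrix (Fin k) (Fin l) R) : Set R :=
  {f | ∃ (r : Fin t ↪o Fin k) (c : Fin t ↪o Fin l), f = (M.submatrix r c).det}

/-! ### Gröbner bases and antidiagonal term orders -/

/-- A term order is antidiagonal for `M` if the leading monomial of every minor of `M` is the
leading monomial of the product of the entries on its antidiagonal. -/
def IsAntidiagonal {σ R : Type*} [CommRing R] {k l : ℕ} (m : MonomialOrder σ)
    (M : Matrix (Fin k) (Fin l) (MvPolynomial σ R)) : Prop :=
  ∀ (t : ℕ) (r : Fin t ↪o Fin k) (c : Fin t ↪o Fin l),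
    m.degree (M.submatrix r c).det = m.degree (∏ i : Fin t, M (r i) (c i.rev))

/-- `G` is a Gröbner basis of the ideal `I`: a finite subset of `I` whose leading terms generate
the initial ideal of `I`. -/
def IsGroebnerBasis {σ k : Type*} [Field k] (m : MonomialOrder σ)
    (G : Set (MvPolynomial σ k)) (I : Ideal (MvPolynomial σ k)) : Prop :=
  G.Finite ∧ G ⊆ (I : Set (MvPolynomial σ k)) ∧
    Ideal.span (m.leadingTerm '' G) =
      Ideal.span (m.leadingTerm '' (I : Set (MvPolynomial σ k)))

/-! ### Cohen–Macaulay rings and degree -/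

/-- A Noetherian local ring whose depth equals its Krull dimension: some regular sequence in the
maximal ideal has length the Krull dimension (no regular sequence can be longer). -/
def IsCohenMacaulayLocal (R : Type*) [CommRing R] [IsLocalRing R] : Prop :=
  IsNoetherianRing R ∧ ∃ rs : List R, (∀ r ∈ rs, r ∈ IsLocalRing.maximalIdeal R) ∧
    RingTheory.Sequence.IsRegular R rs ∧ ((rs.length : ℕ∞) : WithBot ℕ∞) = ringKrullDim R

/-- A Noetherian ring all of whose localizations at maximal ideals are Cohen–Macaulay. -/
def IsCohenMacaulay (R : Type*) [CommRing R] : Prop :=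
  IsNoetherianRing R ∧ ∀ (p : Ideal R) [p.IsMaximal], IsCohenMacaulayLocal (Localization.AtPrime p)

/-- Hilbert function of `S / I`, for `I` a homogeneous ideal of the standard graded polynomial
ring `S`: the dimension of the image of the degree-`n` forms in `S / I`. -/
def hilbertFunction {σ k : Type*} [Field k] (I : Ideal (MvPolynomial σ k)) (n : ℕ) : ℕ :=
  Module.finrank k ((homogeneousSubmodule σ k n).map (Ideal.Quotient.mkₐ k I).toLinearMap)

/-- The homogeneous ideal `I` (with `S / I` of positive dimension) has degree `e`: if `P` is the
Hilbert polynomial of `S / I`, of degree `n`, then `e` is `n!` times its leading coefficient. -/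
def HasDegree {σ k : Type*} [Field k] (I : Ideal (MvPolynomial σ k)) (e : ℕ) : Prop :=
  ∃ P : Polynomial ℚ, P ≠ 0 ∧ (∀ᶠ n : ℕ in atTop, (hilbertFunction I n : ℚ) = P.eval (n : ℚ)) ∧
    P.leadingCoeff * (P.natDegree ! : ℚ) = e

/-! ### Scaled rational normal curves and cones -/

/-- The point `(c_0 s^(d-1), c_1 s^(d-2) t, …, c_(d-1) t^(d-1))`. -/
def scaledCurvePoint {d : ℕ} (c : Fin d → ℂ) (s t : ℂ) : Fin d → ℂ :=
  fun i => c i * s ^ (d - 1 - (i : ℕ)) * t ^ (i : ℕ)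

/-- The rational normal curve in `ℙ^(d-1)`, with the coordinates scaled by the `c i ≠ 0`. -/
def scaledRationalNormalCurve {d : ℕ} (c : Fin d → ℂ) : Set (ℙ ℂ (Fin d → ℂ)) :=
  {p | ∃ (s t : ℂ) (h : scaledCurvePoint c s t ≠ 0), p = Projectivization.mk ℂ _ h}

/-- The affine cone over a subset of projective space. -/
def affineCone {d : ℕ} (Z : Set (ℙ ℂ (Fin d → ℂ))) : Set (Fin d → ℂ) :=
  {x | ∀ h : x ≠ 0, Projectivization.mk ℂ x h ∈ Z}

end

/-! Cumulants. Multiplying the inverse Gaussian density by `exp (t * x)` gives a constant times the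
density with `μ` replaced by `μ / ρ`, where `ρ ^ 2 = 1 - 2 μ ^ 2 t / lam`. Every such density has
mass one, by an explicit antiderivative, so the cumulant generating function is `lam / μ * (1 - ρ)`
and can be differentiated termwise.

Algebra. Put `d = m + 1`, `A = μ`, `B = μ ^ 2 / lam` and `y i = κ_(i+1) / (2i-1)!!`. The
parametrization becomes the toric map `y i ↦ A * B ^ i`, and the minors become nonzero multiples of
`y j * y (k+1) - y k * y (j+1)`. Modulo these, a product of two interior variables (`0 < i, j < m`)
collapses to one involving `y 0` or `y m`, so the standard monomials `y 0 ^ k * y i ^ ε * y m ^ b`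
with `0 < i < m` and `ε ≤ 1` span the quotient (`IsRationalNormal.span_standardMonomial`). Their
toric images are pairwise distinct monomials (`standardExponent_injective`).

Everything else follows from this one basis. The quotient embeds in `ℂ[A, B]`, so the minors
generate the toric kernel, a prime ideal (`ker_igToricMap`). The standard monomials are those
divisible by no antidiagonal leading monomial, so division by the minors sends every element of the
ideal to remainder zero (`isGroebnerBasis_minors`). Forms of degree `n` have image spanned by `A ^ n
* B ^ e`, `0 ≤ e ≤ n * m`, whence the Hilbert function `n * m + 1`. The quotient is free over `ℂ[y
0, y m]` with basis `1, y 1, …, y (m-1)`, hence Cohen–Macaulay (`isCohenMacaulay_of_finite_free`).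
The cone statement comes from solving the equations of the minors directly. -/

open Topology

/-! ### The inverse Gaussian distribution -/

/-- Antiderivative of the unnormalized Gaussian density. -/
noncomputable def gaussianPrimitive (y : ℝ) : ℝ := ∫ u in (0 : ℝ)..y, Real.exp (-(1 / 2) * u ^ 2)

theorem hasDerivAt_gaussianPrimitive (y : ℝ) :
    HasDerivAt gaussianPrimitive (Real.exp (-(1 / 2) * y ^ 2)) y := by
  have hc : Continuous fun u : ℝ => Real.exp (-(1 / 2) * u ^ 2) := by fun_prop
  exact intervalIntegral.integral_hasDerivAt_right (hc.intervalIntegrable _ _)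
    (hc.stronglyMeasurableAtFilter _ _) hc.continuousAt

theorem gaussianPrimitive_neg (y : ℝ) : gaussianPrimitive (-y) = -gaussianPrimitive y := by
  have h := intervalIntegral.integral_comp_neg (a := 0) (b := y)
    (fun u : ℝ => Real.exp (-(1 / 2) * u ^ 2))
  simp only [neg_sq, neg_zero] at h
  rw [gaussianPrimitive, gaussianPrimitive, intervalIntegral.integral_symm, h]

theorem tendsto_gaussianPrimitive_atTop :
    Tendsto gaussianPrimitive atTop (𝓝 (√(2 * Real.pi) / 2)) := by
  have h := intervalIntegral_tendsto_integral_Ioi (f := fun u : ℝ => Real.exp (-(1 / 2) * u ^ 2))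
    0 (integrable_exp_neg_mul_sq (by norm_num : (0 : ℝ) < 1 / 2)).integrableOn tendsto_id
  rw [integral_gaussian_Ioi] at h
  rwa [show Real.pi / (1 / 2) = 2 * Real.pi by ring] at h

theorem tendsto_gaussianPrimitive_atBot :
    Tendsto gaussianPrimitive atBot (𝓝 (-(√(2 * Real.pi) / 2))) := by
  have h := (tendsto_gaussianPrimitive_atTop.comp tendsto_neg_atBot_atTop).neg
  refine h.congr fun y => ?_
  simp [gaussianPrimitive_neg]

/-- Antiderivative on `(0, ∞)` of `√(2π)` times the inverse Gaussian density. -/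
noncomputable def inverseGaussianPrimitive (μ lam x : ℝ) : ℝ :=
  gaussianPrimitive (√lam * (√x / μ - 1 / √x)) +
    Real.exp (2 * lam / μ) * gaussianPrimitive (-(√lam * (√x / μ + 1 / √x)))

/-- The squares of `√x / μ - 1 / √x` and `√x / μ + 1 / √x` differ by the constant `4 / μ`. The
factor `exp (2 * lam / μ)` compensates for it, so both summands produce the same exponential and the
algebraic prefactors combine. -/
theorem hasDerivAt_inverseGaussianPrimitive {μ lam x : ℝ} (hμ : 0 < μ) (hl : 0 < lam)
    (hx : 0 < x) :
    HasDerivAt (inverseGaussianPrimitive μ lam)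
      (√(2 * Real.pi) * inverseGaussianPDF μ lam x) x := by
  have hs : 0 < √x := Real.sqrt_pos.2 hx
  have hsx : √x ^ 2 = x := Real.sq_sqrt hx.le
  have hll : √lam ^ 2 = lam := Real.sq_sqrt hl.le
  have hd : HasDerivAt (fun x : ℝ => √x) (1 / (2 * √x)) x := Real.hasDerivAt_sqrt hx.ne'
  have hi : HasDerivAt (fun x : ℝ => 1 / √x) (-(1 / (2 * √x)) / √x ^ 2) x := by
    simpa [Pi.inv_def] using hd.inv hs.ne'
  have h1 := (hasDerivAt_gaussianPrimitive _).comp x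
    (((hd.div_const μ).sub hi).const_mul (√lam))
  have h2 := ((hasDerivAt_gaussianPrimitive _).comp x
    ((((hd.div_const μ).add hi).const_mul (√lam)).neg)).const_mul (Real.exp (2 * lam / μ))
  refine (h1.add h2).congr_deriv ?_
  have e1 : -(1 / 2) * (√lam * (√x / μ - 1 / √x)) ^ 2 =
      -(lam * (x - μ) ^ 2 / (2 * μ ^ 2 * x)) := by
    rw [mul_pow, hll]
    nth_rw 3 4 [← hsx]
    field_simp
  have e2 : Real.exp (2 * lam / μ) * Real.exp (-(1 / 2) * (-(√lam * (√x / μ + 1 / √x))) ^ 2) =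
      Real.exp (-(lam * (x - μ) ^ 2 / (2 * μ ^ 2 * x))) := by
    rw [← Real.exp_add]
    congr 1
    rw [neg_sq, mul_pow, hll]
    nth_rw 3 4 [← hsx]
    field_simp
    ring
  have e3 : √(2 * Real.pi) * √(lam / (2 * Real.pi * x ^ 3)) = √lam / √x ^ 3 := by
    have : x ^ 3 = (√x ^ 3) ^ 2 := by rw [← pow_mul, mul_comm, pow_mul, hsx]
    rw [← Real.sqrt_mul (by positivity)]
    rw [show 2 * Real.pi * (lam / (2 * Real.pi * x ^ 3)) = lam / x ^ 3 by
      field_simp]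
    rw [Real.sqrt_div' _ (by positivity), this, Real.sqrt_sq (by positivity)]
  simp only [Pi.sub_apply, Pi.add_apply, Pi.neg_apply]
  rw [inverseGaussianPDF, if_pos hx, ← mul_assoc (√(2 * Real.pi)), e3,
    ← mul_assoc (Real.exp (2 * lam / μ)), e2, e1]
  field_simp
  ring

theorem tendsto_inverseGaussianPrimitive_atTop {μ lam : ℝ} (hμ : 0 < μ) (hl : 0 < lam) :
    Tendsto (inverseGaussianPrimitive μ lam) atTop
      (𝓝 (√(2 * Real.pi) / 2 + Real.exp (2 * lam / μ) * -(√(2 * Real.pi) / 2))) := by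
  have hl' : 0 < √lam := Real.sqrt_pos.2 hl
  have h1 : Tendsto (fun x : ℝ => √x / μ) atTop atTop :=
    Real.tendsto_sqrt_atTop.atTop_div_const hμ
  have h2 : Tendsto (fun x : ℝ => 1 / √x) atTop (𝓝 0) := by
    simpa [Pi.inv_def] using Real.tendsto_sqrt_atTop.inv_tendsto_atTop
  have h3 := (h1.atTop_add h2.neg).const_mul_atTop hl'
  have h4 := (h1.atTop_add h2).const_mul_atTop hl'
  refine (tendsto_gaussianPrimitive_atTop.comp (h3.congr fun x => ?_)).add
    ((tendsto_gaussianPrimitive_atBot.comp (tendsto_neg_atTop_atBot.comp h4)).const_mul _)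
  simp [sub_eq_add_neg]

theorem tendsto_inverseGaussianPrimitive_zero (μ : ℝ) {lam : ℝ} (hl : 0 < lam) :
    Tendsto (inverseGaussianPrimitive μ lam) (𝓝[>] 0)
      (𝓝 (-(√(2 * Real.pi) / 2) + Real.exp (2 * lam / μ) * -(√(2 * Real.pi) / 2))) := by
  have hl' : 0 < √lam := Real.sqrt_pos.2 hl
  have h0 : Tendsto (fun x : ℝ => √x) (𝓝[>] 0) (𝓝[>] 0) := by
    refine tendsto_nhdsWithin_iff.2 ⟨?_, eventually_mem_nhdsWithin.mono fun x hx =>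
      Real.sqrt_pos.2 hx⟩
    simpa using (Real.continuous_sqrt.tendsto 0).mono_left nhdsWithin_le_nhds
  have h1 : Tendsto (fun x : ℝ => √x / μ) (𝓝[>] 0) (𝓝 0) := by
    simpa using (h0.mono_right nhdsWithin_le_nhds).div_const μ
  have h2 : Tendsto (fun x : ℝ => 1 / √x) (𝓝[>] 0) atTop := by
    simpa [Function.comp_def] using tendsto_inv_nhdsGT_zero.comp h0
  have h3 := tendsto_neg_atTop_atBot.comp ((h2.atTop_add h1.neg).const_mul_atTop hl')
  have h4 := tendsto_neg_atTop_atBot.comp ((h2.atTop_add h1).const_mul_atTop hl')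
  refine (tendsto_gaussianPrimitive_atBot.comp (h3.congr fun x => ?_)).add
    ((tendsto_gaussianPrimitive_atBot.comp (h4.congr fun x => ?_)).const_mul _)
  · simp only [Function.comp]; ring
  · simp only [Function.comp]; ring

theorem inverseGaussianPDF_nonneg (μ lam x : ℝ) : 0 ≤ inverseGaussianPDF μ lam x := by
  rw [inverseGaussianPDF]
  split_ifs <;> positivity

theorem measurable_inverseGaussianPDF (μ lam : ℝ) : Measurable (inverseGaussianPDF μ lam) := by
  refine Measurable.ite measurableSet_Ioi ?_ measurable_const
  fun_prop

theorem inverseGaussianPDF_eq_indicator (μ lam : ℝ) :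
    inverseGaussianPDF μ lam = (Set.Ioi 0).indicator (inverseGaussianPDF μ lam) := by
  ext x
  by_cases hx : 0 < x
  · rw [Set.indicator_of_mem (Set.mem_Ioi.2 hx)]
  · rw [Set.indicator_of_notMem (by simpa using hx), inverseGaussianPDF, if_neg hx]

theorem integrable_and_integral_inverseGaussianPDF {μ lam : ℝ} (hμ : 0 < μ) (hl : 0 < lam) :
    Integrable (inverseGaussianPDF μ lam) ∧ ∫ x, inverseGaussianPDF μ lam x = 1 := by
  set L := -(√(2 * Real.pi) / 2) + Real.exp (2 * lam / μ) * -(√(2 * Real.pi) / 2) with hL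
  -- The formula gives a junk value at `0`; it is replaced by the right limit, since the improper
  -- integral needs continuity at the endpoint.
  set g := Function.update (inverseGaussianPrimitive μ lam) 0 L
  have hpi : √(2 * Real.pi) ≠ 0 := by positivity
  have hcont : ContinuousWithinAt g (Set.Ici 0) 0 := by
    rw [continuousWithinAt_update_same, Set.Ici_sdiff_left]
    exact tendsto_inverseGaussianPrimitive_zero μ hl
  have hderiv : ∀ x ∈ Set.Ioi (0 : ℝ),
      HasDerivAt g (√(2 * Real.pi) * inverseGaussianPDF μ lam x) x := by
    intro x hx
    refine (hasDerivAt_inverseGaussianPrimitive hμ hl hx).congr_of_eventuallyEq ?_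
    filter_upwards [lt_mem_nhds hx] with y hy
    exact Function.update_of_ne hy.ne' _ _
  have hpos : ∀ x ∈ Set.Ioi (0 : ℝ), 0 ≤ √(2 * Real.pi) * inverseGaussianPDF μ lam x :=
    fun x _ => mul_nonneg (Real.sqrt_nonneg _) (inverseGaussianPDF_nonneg _ _ _)
  have hlim : Tendsto g atTop
      (𝓝 (√(2 * Real.pi) / 2 + Real.exp (2 * lam / μ) * -(√(2 * Real.pi) / 2))) := by
    refine (tendsto_inverseGaussianPrimitive_atTop hμ hl).congr' ?_
    filter_upwards [eventually_gt_atTop 0] with y hy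
    exact (Function.update_of_ne hy.ne' _ _).symm
  have hint := integrableOn_Ioi_deriv_of_nonneg hcont hderiv hpos hlim
  have hval := integral_Ioi_of_hasDerivAt_of_nonneg hcont hderiv hpos hlim
  constructor
  · rw [inverseGaussianPDF_eq_indicator, integrable_indicator_iff measurableSet_Ioi]
    have := hint.const_mul (√(2 * Real.pi))⁻¹
    simp only [← mul_assoc, inv_mul_cancel₀ hpi, one_mul] at this
    exact this
  · rw [inverseGaussianPDF_eq_indicator, integral_indicator measurableSet_Ioi]
    rw [integral_const_mul, show g 0 = L from Function.update_self _ _ _, hL] at hval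
    refine mul_left_cancel₀ hpi (hval.trans ?_)
    ring

theorem isProbabilityMeasure_inverseGaussian {μ lam : ℝ} (hμ : 0 < μ) (hl : 0 < lam) :
    IsProbabilityMeasure (inverseGaussian μ lam) := by
  obtain ⟨hi, h1⟩ := integrable_and_integral_inverseGaussianPDF hμ hl
  constructor
  rw [inverseGaussian, withDensity_apply _ MeasurableSet.univ, Measure.restrict_univ,
    ← ofReal_integral_eq_lintegral_ofReal hi
      (Eventually.of_forall fun x => inverseGaussianPDF_nonneg _ _ _), h1, ENNReal.ofReal_one]

theorem integral_inverseGaussian (μ lam : ℝ) (f : ℝ → ℝ) :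
    ∫ x, f x ∂(inverseGaussian μ lam) = ∫ x, inverseGaussianPDF μ lam x * f x := by
  rw [inverseGaussian, integral_withDensity_eq_integral_toReal_smul
    (measurable_inverseGaussianPDF _ _).ennreal_ofReal (Eventually.of_forall fun _ => by simp)]
  simp [ENNReal.toReal_ofReal (inverseGaussianPDF_nonneg _ _ _)]

/-! ### Cumulants by exponential tilting -/

/-- Exponential tilting of an inverse Gaussian density gives a multiple of another one. -/
theorem inverseGaussianPDF_mul_exp {μ lam t ρ : ℝ} (hμ : 0 < μ) (hl : 0 < lam) (hρ : 0 < ρ)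
    (h : ρ ^ 2 = 1 - 2 * μ ^ 2 * t / lam) (x : ℝ) :
    inverseGaussianPDF μ lam x * Real.exp (t * x) =
      Real.exp (lam / μ * (1 - ρ)) * inverseGaussianPDF (μ / ρ) lam x := by
  have ht : t = (1 - ρ ^ 2) * lam / (2 * μ ^ 2) := by
    rw [h]; field_simp; ring
  by_cases hx : 0 < x
  · rw [inverseGaussianPDF, inverseGaussianPDF, if_pos hx, if_pos hx, mul_assoc, ← Real.exp_add,
      mul_left_comm, ← Real.exp_add]
    congr 2
    rw [ht]
    field_simp
    ring
  · simp [inverseGaussianPDF, hx]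

theorem cgf_inverseGaussian {μ lam t : ℝ} (hμ : 0 < μ) (hl : 0 < lam)
    (ht : 0 < 1 - 2 * μ ^ 2 * t / lam) :
    cgf (id : ℝ → ℝ) (inverseGaussian μ lam) t =
      lam / μ * (1 - (1 - 2 * μ ^ 2 * t / lam) ^ (1 / 2 : ℝ)) := by
  have hρ := Real.sqrt_pos.2 ht
  rw [← Real.sqrt_eq_rpow, cgf, mgf, integral_inverseGaussian]
  simp only [id, inverseGaussianPDF_mul_exp hμ hl hρ (Real.sq_sqrt ht.le)]
  rw [integral_const_mul, (integrable_and_integral_inverseGaussianPDF (div_pos hμ hρ) hl).2,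
    mul_one, Real.log_exp]

theorem iteratedDeriv_cgf_inverseGaussian {μ lam : ℝ} (hμ : 0 < μ) (hl : 0 < lam) (r : ℕ) :
    ∀ t : ℝ, 0 < 1 - 2 * μ ^ 2 * t / lam →
      iteratedDeriv (r + 1) (cgf (id : ℝ → ℝ) (inverseGaussian μ lam)) t =
        ((2 * r - 1)‼ : ℝ) * μ ^ (2 * r + 1) / lam ^ r *
          (1 - 2 * μ ^ 2 * t / lam) ^ (-(r : ℝ) - 1 / 2) := by
  -- The induction runs over all `t` in this open half-line, not only `t = 0`, because
  -- differentiating once more needs the formula near `t`.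
  have hnhds : ∀ t : ℝ, 0 < 1 - 2 * μ ^ 2 * t / lam →
      ∀ᶠ u in 𝓝 t, 0 < 1 - 2 * μ ^ 2 * u / lam := fun t ht =>
    (show ContinuousAt (fun u : ℝ => 1 - 2 * μ ^ 2 * u / lam) t by fun_prop).eventually
      (lt_mem_nhds ht)
  have hpow : ∀ (p t : ℝ), 0 < 1 - 2 * μ ^ 2 * t / lam →
      HasDerivAt (fun u : ℝ => (1 - 2 * μ ^ 2 * u / lam) ^ p)
        (-(2 * μ ^ 2 / lam) * p * (1 - 2 * μ ^ 2 * t / lam) ^ (p - 1)) t := by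
    intro p t ht
    have h : HasDerivAt (fun u : ℝ => 1 - 2 * μ ^ 2 * u / lam) (-(2 * μ ^ 2 / lam)) t := by
      simpa using (((hasDerivAt_id t).const_mul (2 * μ ^ 2)).div_const lam).const_sub 1
    exact h.rpow_const (Or.inl ht.ne')
  induction r with
  | zero =>
    intro t ht
    rw [zero_add, iteratedDeriv_one]
    have he : cgf (id : ℝ → ℝ) (inverseGaussian μ lam) =ᶠ[𝓝 t]
        fun u => lam / μ * (1 - (1 - 2 * μ ^ 2 * u / lam) ^ (1 / 2 : ℝ)) :=
      (hnhds t ht).mono fun u hu => cgf_inverseGaussian hμ hl hu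
    rw [he.deriv_eq, (((hpow _ t ht).const_sub 1).const_mul _).deriv]
    norm_num
    field_simp
  | succ r ih =>
    intro t ht
    rw [iteratedDeriv_succ]
    have he : iteratedDeriv (r + 1) (cgf (id : ℝ → ℝ) (inverseGaussian μ lam)) =ᶠ[𝓝 t]
        fun u => ((2 * r - 1)‼ : ℝ) * μ ^ (2 * r + 1) / lam ^ r *
          (1 - 2 * μ ^ 2 * u / lam) ^ (-(r : ℝ) - 1 / 2) :=
      (hnhds t ht).mono ih
    have hdf : (2 * (r + 1) - 1)‼ = (2 * r + 1) * (2 * r - 1)‼ := by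
      cases r with
      | zero => rfl
      | succ k => exact Nat.doubleFactorial_add_two (2 * k + 1)
    rw [he.deriv_eq, ((hpow _ t ht).const_mul _).deriv, hdf]
    push_cast
    rw [show -((r : ℝ) + 1) - 1 / 2 = -(r : ℝ) - 1 / 2 - 1 by ring]
    field_simp
    ring

theorem cumulant_inverseGaussian {μ lam : ℝ} (hμ : 0 < μ) (hl : 0 < lam) {r : ℕ} (hr : 1 ≤ r) :
    (cumulant (inverseGaussian μ lam) r : ℂ) = igCumulant μ lam r := by
  obtain ⟨r, rfl⟩ := Nat.exists_eq_add_of_le' hr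
  rw [cumulant, iteratedDeriv_cgf_inverseGaussian hμ hl r 0 (by simp), igCumulant,
    show 2 * (r + 1) - 3 = 2 * r - 1 by omega, show 2 * (r + 1) - 1 = 2 * r + 1 by omega,
    Nat.add_sub_cancel]
  simp

/-! ### Sequences satisfying the equations of the rational normal curve -/

section RationalNormalSequence

variable {R : Type*} [CommRing R]

/-- The elements `y 0, …, y m` satisfy the `2 × 2` minor equations of the rational normal curve. -/
def IsRationalNormal (m : ℕ) (y : ℕ → R) : Prop :=
  ∀ j k, j < k → k < m → y j * y (k + 1) = y k * y (j + 1)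

/-- Each minor equation moves one unit from the smaller index to the larger; repeat until the
smaller is `0`. -/
theorem IsRationalNormal.mul_eq_zero_mul {m : ℕ} {y : ℕ → R} (h : IsRationalNormal m y) :
    ∀ i j, i ≤ j → i + j ≤ m → y i * y j = y 0 * y (i + j)
  | 0, j, _, _ => by rw [zero_add]
  | i + 1, j, hij, hm => by
    rw [mul_comm, ← h i j (by omega) (by omega), h.mul_eq_zero_mul i (j + 1) (by omega) (by omega)]
    congr 2
    omega

/-- The same transfer of index units, stopped when the larger index reaches `m`. -/
theorem IsRationalNormal.mul_eq_mul_last {m : ℕ} {y : ℕ → R} (h : IsRationalNormal m y)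
    {i j : ℕ} (hij : i ≤ j) (hj : j ≤ m) (hm : m ≤ i + j) :
    y i * y j = y (i + j - m) * y m := by
  obtain ⟨n, rfl⟩ := Nat.exists_eq_add_of_le hj
  induction n generalizing i j with
  | zero => simp
  | succ n ih =>
    obtain ⟨i, rfl⟩ : ∃ i', i = i' + 1 := ⟨i - 1, by omega⟩
    have e : j + (n + 1) = j + 1 + n := by omega
    rw [mul_comm, ← h i j (by omega) (by omega)]
    rw [e] at h hm hj ⊢
    rw [ih (i := i) (j := j + 1) (by omega) h (by omega) (by omega)]
    congr 2
    omega

/-- The element `1` for `i = 0` and `y i` for `i > 0`. -/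
def middleFactor (y : ℕ → R) (i : ℕ) : R := if i = 0 then 1 else y i

/-- The standard monomial `y 0 ^ k * y i * y m ^ b`, where `y i` is left out for `i = 0`. -/
def standardMonomial (m : ℕ) (y : ℕ → R) (p : ℕ × Fin m × ℕ) : R :=
  y 0 ^ p.1 * middleFactor y p.2.1 * y m ^ p.2.2

theorem IsRationalNormal.mul_standardMonomial {m : ℕ} {y : ℕ → R} (h : IsRationalNormal m y)
    (hm : 1 ≤ m) {j : ℕ} (hj : j ≤ m) (p : ℕ × Fin m × ℕ) :
    ∃ q, y j * standardMonomial m y p = standardMonomial m y q := by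
  obtain ⟨k, ⟨i, hi⟩, b⟩ := p
  simp only [standardMonomial, middleFactor]
  rcases Nat.eq_zero_or_pos j with rfl | hj0
  · exact ⟨(k + 1, ⟨i, hi⟩, b), by simp only; ring⟩
  rcases hj.eq_or_lt with rfl | hjm
  · exact ⟨(k, ⟨i, hi⟩, b + 1), by simp only; ring⟩
  rcases Nat.eq_zero_or_pos i with rfl | hi0
  · exact ⟨(k, ⟨j, hjm⟩, b), by simp only [hj0.ne', if_true, if_false]; ring⟩
  have hcomm : ∀ z, y j * y i = z →
      y j * (y 0 ^ k * (if i = 0 then 1 else y i) * y m ^ b) = y 0 ^ k * z * y m ^ b := by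
    rintro z rfl
    rw [if_neg hi0.ne']
    ring
  have hmm : ∀ z, (i ≤ j → y i * y j = z) → (j ≤ i → y j * y i = z) → y j * y i = z := by
    intro z h1 h2
    rcases le_total i j with hij | hij
    · rw [mul_comm, h1 hij]
    · exact h2 hij
  rcases lt_trichotomy (i + j) m with hlt | heq | hgt
  · refine ⟨(k + 1, ⟨i + j, hlt⟩, b), ?_⟩
    rw [hcomm (y 0 * y (i + j)) (hmm _ (fun hij => h.mul_eq_zero_mul i j hij hlt.le) fun hij => by
      rw [add_comm i j]; exact h.mul_eq_zero_mul j i hij (by omega))]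
    simp only [show i + j ≠ 0 by omega, if_false]
    ring
  · refine ⟨(k + 1, ⟨0, hm⟩, b + 1), ?_⟩
    rw [hcomm (y 0 * y (i + j)) (hmm _ (fun hij => h.mul_eq_zero_mul i j hij heq.le) fun hij => by
      rw [add_comm i j]; exact h.mul_eq_zero_mul j i hij (by omega)), heq]
    simp only [if_true]
    ring
  · refine ⟨(k, ⟨i + j - m, by omega⟩, b + 1), ?_⟩
    rw [hcomm (y (i + j - m) * y m)
      (hmm _ (fun hij => h.mul_eq_mul_last hij hj hgt.le) fun hij => by
        rw [add_comm i j]; exact h.mul_eq_mul_last hij hi.le (by omega))]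
    simp only [show i + j - m ≠ 0 by omega, if_false]
    ring

theorem IsRationalNormal.span_standardMonomial [Algebra ℂ R] {m : ℕ} {y : ℕ → R}
    (h : IsRationalNormal m y) (hm : 1 ≤ m) (hy : Algebra.adjoin ℂ (y '' Set.Iic m) = ⊤) :
    Submodule.span ℂ (Set.range (standardMonomial m y)) = ⊤ := by
  rw [eq_top_iff]
  rintro x -
  -- The span contains `1`, so it is enough that it is stable under multiplication by the algebra,
  -- which can be checked on generators.
  suffices H : ∀ x ∈ Algebra.adjoin ℂ (y '' Set.Iic m), ∀ z ∈
      Submodule.span ℂ (Set.range (standardMonomial m y)),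
      x * z ∈ Submodule.span ℂ (Set.range (standardMonomial m y)) by
    rw [← mul_one x]
    refine H x (hy ▸ Algebra.mem_top) 1 (Submodule.subset_span ⟨(0, ⟨0, hm⟩, 0), ?_⟩)
    simp [standardMonomial, middleFactor]
  intro x hx
  induction hx using Algebra.adjoin_induction with
  | mem x hx =>
    obtain ⟨j, hj, rfl⟩ := hx
    intro z hz
    induction hz using Submodule.span_induction with
    | mem z hz =>
      obtain ⟨p, rfl⟩ := hz
      obtain ⟨q, hq⟩ := h.mul_standardMonomial hm hj p
      exact hq ▸ Submodule.subset_span ⟨q, rfl⟩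
    | zero => simp
    | add z w _ _ hz hw => rw [mul_add]; exact add_mem hz hw
    | smul a z _ hz => rw [mul_smul_comm]; exact Submodule.smul_mem _ _ hz
  | algebraMap a =>
    intro z hz
    rw [← Algebra.smul_def]
    exact Submodule.smul_mem _ _ hz
  | add x w _ _ hx hw => intro z hz; rw [add_mul]; exact add_mem (hx z hz) (hw z hz)
  | mul x w _ _ hx hw => intro z hz; rw [mul_assoc]; exact hx _ (hw z hz)

end RationalNormalSequence

/-! ### The toric parametrization -/

/-- The sequence `A * B ^ i` in `ℂ[A, B]`. -/
noncomputable def toricSeq (i : ℕ) : MvPolynomial (Fin 2) ℂ := X 0 * X 1 ^ i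

/-- The exponent of the monomial `A ^ k * B ^ i`. -/
noncomputable def toricExponent (k i : ℕ) : Fin 2 →₀ ℕ :=
  Finsupp.single 0 k + Finsupp.single 1 i

theorem toricExponent_inj {k i k' i' : ℕ} :
    toricExponent k i = toricExponent k' i' ↔ k = k' ∧ i = i' := by
  refine ⟨fun h => ⟨?_, ?_⟩, by rintro ⟨rfl, rfl⟩; rfl⟩
  · simpa [toricExponent] using DFunLike.congr_fun h 0
  · simpa [toricExponent] using DFunLike.congr_fun h 1

theorem toricMonomial_eq (k i : ℕ) :
    (X 0 ^ k * X 1 ^ i : MvPolynomial (Fin 2) ℂ) = monomial (toricExponent k i) 1 := by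
  rw [X_pow_eq_monomial, X_pow_eq_monomial, monomial_mul, one_mul, toricExponent]

/-- The exponent of the image of a standard monomial. -/
noncomputable def standardExponent (m : ℕ) (p : ℕ × Fin m × ℕ) : Fin 2 →₀ ℕ :=
  toricExponent (p.1 + (if (p.2.1 : ℕ) = 0 then 0 else 1) + p.2.2) (p.2.1 + m * p.2.2)

/-- The exponent of `B` is `i + m * b` with `i < m`, so Euclidean division recovers `b` and `i`; the
exponent of `A` then gives `k`. -/
theorem standardExponent_injective (m : ℕ) : Function.Injective (standardExponent m) := by
  rintro ⟨k, ⟨i, hi⟩, b⟩ ⟨k', ⟨i', hi'⟩, b'⟩ h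
  obtain ⟨h1, h2⟩ := toricExponent_inj.1 h
  simp only at h1 h2
  have hm : 0 < m := by omega
  obtain rfl : b = b' := by
    have := congrArg (· / m) h2
    simpa [Nat.add_mul_div_left _ _ hm, Nat.div_eq_of_lt hi, Nat.div_eq_of_lt hi'] using this
  obtain rfl : i = i' := by omega
  obtain rfl : k = k' := by omega
  rfl

theorem standardMonomial_toricSeq (m : ℕ) (p : ℕ × Fin m × ℕ) :
    standardMonomial m toricSeq p = monomial (standardExponent m p) 1 := by
  obtain ⟨k, ⟨i, hi⟩, b⟩ := p
  rw [standardExponent, ← toricMonomial_eq, standardMonomial, middleFactor]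
  simp only [toricSeq]
  split_ifs with h
  · subst h; ring
  · ring

theorem linearIndependent_standardMonomial_toricSeq (m : ℕ) :
    LinearIndependent ℂ (standardMonomial m toricSeq) := by
  have h := (basisMonomials (Fin 2) ℂ).linearIndependent.comp _ (standardExponent_injective m)
  have e : standardMonomial m toricSeq = basisMonomials (Fin 2) ℂ ∘ standardExponent m := by
    ext1 p
    rw [standardMonomial_toricSeq, Function.comp_apply, coe_basisMonomials]
  exact e ▸ h

/-- A linear map sending a spanning family to a linearly independent one is injective. -/
theorem LinearMap.injective_of_span_of_linearIndependent {ι k V W : Type*} [Field k]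
    [AddCommGroup V] [Module k V] [AddCommGroup W] [Module k W] (f : V →ₗ[k] W) {v : ι → V}
    (hv : Submodule.span k (Set.range v) = ⊤) (hw : LinearIndependent k fun i => f (v i)) :
    Function.Injective f := by
  rw [injective_iff_map_eq_zero]
  intro x hx
  obtain ⟨c, rfl⟩ := (Finsupp.mem_span_range_iff_exists_finsupp (R := k)).1
    (hv ▸ Submodule.mem_top : x ∈ _)
  rw [map_finsuppSum] at hx
  simp only [map_smul] at hx
  have hc : c = 0 := linearIndependent_iff.1 hw c (by rw [Finsupp.linearCombination_apply]; exact hx)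
  simp [hc]

/-! ### The scaled toric ideal -/

/-- The scaling factors `(2i - 1)!!`. -/
noncomputable def igScale (i : ℕ) : ℂ := ((2 * i - 1)‼ : ℂ)

theorem igScale_ne_zero (i : ℕ) : igScale i ≠ 0 :=
  Nat.cast_ne_zero.2 (Nat.doubleFactorial_pos _).ne'

theorem igScale_succ (i : ℕ) : igScale (i + 1) = (2 * i + 1) * igScale i := by
  have hdf : (2 * (i + 1) - 1)‼ = (2 * i + 1) * (2 * i - 1)‼ := by
    cases i with
    | zero => rfl
    | succ k => exact Nat.doubleFactorial_add_two (2 * k + 1)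
  rw [igScale, igScale, hdf]
  push_cast
  ring

/-- The parametrization `κ_(i+1) ↦ (2i - 1)!! * A * B ^ i`. -/
noncomputable def igToricMap (d : ℕ) : MvPolynomial (Fin d) ℂ →ₐ[ℂ] MvPolynomial (Fin 2) ℂ :=
  aeval fun i => C (igScale i) * toricSeq i

/-- The rescaled variables `κ_(i+1) / (2i - 1)!!`. -/
noncomputable def igVar (d i : ℕ) : MvPolynomial (Fin d) ℂ :=
  if h : i < d then C (igScale i)⁻¹ * X ⟨i, h⟩ else 0

theorem X_eq_igVar {d : ℕ} (i : Fin d) : X i = C (igScale i) * igVar d i := by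
  rw [igVar, dif_pos i.2, ← mul_assoc, ← C_mul, mul_inv_cancel₀ (igScale_ne_zero _), C_1, one_mul]

theorem igToricMap_igVar {d i : ℕ} (hi : i < d) : igToricMap d (igVar d i) = toricSeq i := by
  rw [igVar, dif_pos hi, igToricMap, map_mul, aeval_X, algHom_C, ← mul_assoc,
    algebraMap_eq, ← C_mul, inv_mul_cancel₀ (igScale_ne_zero _), C_1, one_mul]

theorem adjoin_igVar (m : ℕ) : Algebra.adjoin ℂ (igVar (m + 1) '' Set.Iic m) = ⊤ := by
  rw [eq_top_iff, ← adjoin_range_X, Algebra.adjoin_le_iff]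
  rintro _ ⟨i, rfl⟩
  have hi : igVar (m + 1) i ∈ Algebra.adjoin ℂ (igVar (m + 1) '' Set.Iic m) :=
    Algebra.subset_adjoin (Set.mem_image_of_mem _ (Set.mem_Iic.2 (Nat.lt_succ_iff.1 i.2)))
  have h := Subalgebra.smul_mem _ hi (igScale i)
  rw [smul_eq_C_mul, ← X_eq_igVar] at h
  exact h

/-- The minor of the columns `j` and `k` of the cumulant matrix. -/
noncomputable def igMinor (m : ℕ) (j k : Fin m) : MvPolynomial (Fin (m + 1)) ℂ :=
  C (2 * (j : ℂ) + 1) * X j.castSucc * X k.succ - C (2 * (k : ℂ) + 1) * X k.castSucc * X j.succ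

theorem igMinor_eq (m : ℕ) (j k : Fin m) :
    igMinor m j k = C (igScale (j + 1) * igScale (k + 1)) *
      (igVar (m + 1) j * igVar (m + 1) (k + 1) - igVar (m + 1) k * igVar (m + 1) (j + 1)) := by
  rw [igMinor, X_eq_igVar, X_eq_igVar, X_eq_igVar, X_eq_igVar]
  simp only [Fin.val_castSucc, Fin.val_succ, igScale_succ, C_mul]
  ring

theorem strictMono_pair {α : Type*} [Preorder α] {j k : α} (h : j < k) : StrictMono ![j, k] := by
  rw [Fin.strictMono_iff_lt_succ]
  intro i
  obtain rfl : i = 0 := Subsingleton.elim _ _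
  exact h

theorem minors_igCumulantMatrix (m : ℕ) :
    minors 2 (igCumulantMatrix (m + 1)) = {f | ∃ j k : Fin m, j < k ∧ f = igMinor m j k} := by
  have hdet : ∀ (r : Fin 2 ↪o Fin 2) (c : Fin 2 ↪o Fin m),
      ((igCumulantMatrix (m + 1)).submatrix r c).det = igMinor m (c 0) (c 1) := by
    intro r c
    have h01 : r 0 < r 1 := r.strictMono (by decide)
    have h0 : r 0 = 0 := by omega
    have h1 : r 1 = 1 := by omega
    rw [Matrix.det_fin_two]
    simp only [Matrix.submatrix_apply, h0, h1, igCumulantMatrix, igMinor, Matrix.of_apply]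
    rfl
  ext f
  constructor
  · rintro ⟨r, c, rfl⟩
    exact ⟨c 0, c 1, c.strictMono (by decide), hdet r c⟩
  · rintro ⟨j, k, hjk, rfl⟩
    refine ⟨RelEmbedding.refl _, OrderEmbedding.ofStrictMono ![j, k] (strictMono_pair hjk), ?_⟩
    rw [hdet]
    rfl

theorem igToricMap_igMinor (m : ℕ) (j k : Fin m) : igToricMap (m + 1) (igMinor m j k) = 0 := by
  rw [igMinor_eq, map_mul (igToricMap (m + 1)), map_sub,
    map_mul _ (igVar (m + 1) j), map_mul _ (igVar (m + 1) k), igToricMap_igVar (by omega),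
    igToricMap_igVar (by omega), igToricMap_igVar (by omega), igToricMap_igVar (by omega)]
  simp only [toricSeq]
  ring

/-! ### The ideal of minors is the toric kernel -/

/-- The ideal generated by the minors. -/
noncomputable def igIdeal (m : ℕ) : Ideal (MvPolynomial (Fin (m + 1)) ℂ) :=
  Ideal.span (minors 2 (igCumulantMatrix (m + 1)))

theorem igIdeal_le_ker (m : ℕ) : igIdeal m ≤ RingHom.ker (igToricMap (m + 1)) := by
  rw [igIdeal, minors_igCumulantMatrix, Ideal.span_le]
  rintro _ ⟨j, k, -, rfl⟩
  exact igToricMap_igMinor m j k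

/-- The parametrization on the quotient by the minors. -/
noncomputable def igQuotientMap (m : ℕ) :
    (MvPolynomial (Fin (m + 1)) ℂ ⧸ igIdeal m) →ₐ[ℂ] MvPolynomial (Fin 2) ℂ :=
  Ideal.Quotient.liftₐ (igIdeal m) (igToricMap (m + 1)) fun _ h => igIdeal_le_ker m h

/-- The rescaled variables in the quotient by the minors. -/
noncomputable def igClass (m i : ℕ) : MvPolynomial (Fin (m + 1)) ℂ ⧸ igIdeal m :=
  Ideal.Quotient.mk _ (igVar (m + 1) i)

theorem igQuotientMap_igClass {m i : ℕ} (hi : i ≤ m) :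
    igQuotientMap m (igClass m i) = toricSeq i :=
  igToricMap_igVar (Nat.lt_succ_of_le hi)

theorem isRationalNormal_igClass (m : ℕ) : IsRationalNormal m (igClass m) := by
  intro j k hjk hk
  have h : igMinor m ⟨j, hjk.trans hk⟩ ⟨k, hk⟩ ∈ igIdeal m := by
    refine Ideal.subset_span ?_
    rw [minors_igCumulantMatrix]
    exact ⟨_, _, hjk, rfl⟩
  rw [igMinor_eq] at h
  have h' := (igIdeal m).mul_mem_left (C (igScale (j + 1) * igScale (k + 1))⁻¹) h
  rw [← mul_assoc, ← C_mul, inv_mul_cancel₀ (mul_ne_zero (igScale_ne_zero _) (igScale_ne_zero _)),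
    C_1, one_mul] at h'
  rw [igClass, igClass, igClass, igClass, ← map_mul, ← map_mul]
  exact Ideal.Quotient.eq.2 h'

theorem span_standardMonomial_igClass {m : ℕ} (hm : 1 ≤ m) :
    Submodule.span ℂ (Set.range (standardMonomial m (igClass m))) = ⊤ := by
  refine (isRationalNormal_igClass m).span_standardMonomial hm ?_
  have h := congrArg (Subalgebra.map (Ideal.Quotient.mkₐ ℂ (igIdeal m))) (adjoin_igVar m)
  rw [AlgHom.map_adjoin, ← Set.image_comp, Algebra.map_top,
    (AlgHom.range_eq_top _).2 (Ideal.Quotient.mkₐ_surjective ℂ _)] at h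
  exact h

theorem igQuotientMap_standardMonomial {m : ℕ} (p : ℕ × Fin m × ℕ) :
    igQuotientMap m (standardMonomial m (igClass m) p) = monomial (standardExponent m p) 1 := by
  rw [← standardMonomial_toricSeq]
  obtain ⟨k, ⟨i, hi⟩, b⟩ := p
  simp only [standardMonomial, middleFactor, map_mul, map_pow, apply_ite (igQuotientMap m), map_one,
    igQuotientMap_igClass (Nat.zero_le m), igQuotientMap_igClass le_rfl,
    igQuotientMap_igClass hi.le]

theorem igQuotientMap_injective {m : ℕ} (hm : 1 ≤ m) : Function.Injective (igQuotientMap m) := by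
  refine LinearMap.injective_of_span_of_linearIndependent (igQuotientMap m).toLinearMap
    (span_standardMonomial_igClass hm) ?_
  have e : (fun p => (igQuotientMap m).toLinearMap (standardMonomial m (igClass m) p)) =
      standardMonomial m toricSeq := by
    ext1 p
    rw [standardMonomial_toricSeq]
    exact igQuotientMap_standardMonomial p
  exact e ▸ linearIndependent_standardMonomial_toricSeq m

theorem ker_igToricMap {m : ℕ} (hm : 1 ≤ m) : RingHom.ker (igToricMap (m + 1)) = igIdeal m := by
  refine le_antisymm (fun f hf => ?_) (igIdeal_le_ker m)
  rw [← Ideal.Quotient.eq_zero_iff_mem]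
  refine igQuotientMap_injective hm ?_
  rw [map_zero]
  exact hf

theorem igIdeal_isPrime {m : ℕ} (hm : 1 ≤ m) : (igIdeal m).IsPrime :=
  ker_igToricMap hm ▸ RingHom.ker_isPrime _

/-! ### The vanishing ideal and the variety -/

theorem aeval_igToricMap (d : ℕ) (x : Fin 2 → ℂ) (f : MvPolynomial (Fin d) ℂ) :
    aeval x (igToricMap d f) = aeval (fun i : Fin d => igScale i * (x 0 * x 1 ^ (i : ℕ))) f := by
  have : (aeval x).comp (igToricMap d) =
      aeval (fun i : Fin d => igScale i * (x 0 * x 1 ^ (i : ℕ))) := by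
    ext i
    simp [igToricMap, toricSeq]
  exact DFunLike.congr_fun this f

/-- The substitution `A = μ`, `B = μ ^ 2 / lam` makes the parametrization toric. For `i = 0` both
truncated subtractions give `0‼ = 1`. -/
theorem igCumulant_eq (μ lam : ℂ) (i : ℕ) :
    igCumulant μ lam (i + 1) = igScale i * (μ * (μ ^ 2 / lam) ^ i) := by
  rw [igCumulant, igScale, show 2 * (i + 1) - 3 = 2 * i - 1 by omega,
    show 2 * (i + 1) - 1 = 2 * i + 1 by omega, Nat.add_sub_cancel]
  rw [div_pow, ← pow_mul, pow_succ]
  ring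

theorem vanishingIdeal_zariskiClosure {σ : Type*} (V : Set (σ → ℂ)) :
    vanishingIdeal ℂ (zariskiClosure V) = vanishingIdeal ℂ V :=
  zeroLocus_vanishingIdeal_galoisConnection.u_l_u_eq_u (V : (Set (σ → ℂ))ᵒᵈ)

theorem vanishingIdeal_igCumulantVariety (d : ℕ) :
    vanishingIdeal ℂ (igCumulantVariety d) = RingHom.ker (igToricMap d) := by
  rw [igCumulantVariety, vanishingIdeal_zariskiClosure]
  ext f
  rw [mem_vanishingIdeal_iff, RingHom.mem_ker]
  constructor
  · intro h
    -- The inverse substitution `μ = A`, `lam = A ^ 2 / B` needs `A` and `B` nonzero; the factor `X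
    -- 0 * X 1` absorbs the remaining points and is cancelled in the domain.
    have hz : X 0 * X 1 * igToricMap d f = 0 := by
      refine MvPolynomial.funext fun x => ?_
      by_cases h0 : x 0 = 0
      · simp [h0]
      by_cases h1 : x 1 = 0
      · simp [h1]
      rw [map_mul, map_zero]
      refine mul_eq_zero_of_right _ ?_
      rw [← coe_aeval_eq_eval]
      refine (aeval_igToricMap d x f).trans (h _ ⟨x 0, x 0 ^ 2 / x 1, by simp [h0, h1], fun i => ?_⟩)
      rw [igCumulant_eq]
      field_simp
    simpa [X_ne_zero] using hz
  · rintro h x ⟨μ, lam, hlam, hx⟩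
    have := aeval_igToricMap d ![μ, μ ^ 2 / lam] f
    rw [h, map_zero] at this
    rw [this]
    congr 2
    ext i
    rw [hx, igCumulant_eq]
    simp

theorem vanishingIdeal_igCumulantVariety_eq_igIdeal {m : ℕ} (hm : 1 ≤ m) :
    vanishingIdeal ℂ (igCumulantVariety (m + 1)) = igIdeal m := by
  rw [vanishingIdeal_igCumulantVariety, ker_igToricMap hm]

/-! ### Number and shape of the minors -/

theorem isHomogeneous_igMinor (m : ℕ) (j k : Fin m) : (igMinor m j k).IsHomogeneous 2 := by
  have h : ∀ (a : ℂ) (p q : Fin (m + 1)), (C a * X p * X q).IsHomogeneous 2 := fun a p q => by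
    simpa using ((isHomogeneous_C (Fin (m + 1)) a).mul (isHomogeneous_X ℂ p)).mul
      (isHomogeneous_X ℂ q)
  exact (h _ _ _).sub (h _ _ _)

theorem C_mul_X_mul_X {σ : Type*} (a : ℂ) (p q : σ) :
    C a * X p * X q = monomial (Finsupp.single p 1 + Finsupp.single q 1) a := by
  rw [X, X, C_mul_monomial, monomial_mul, mul_one, mul_one]

theorem single_add_single_ne {m : ℕ} {j k : Fin m} (hjk : j < k) :
    Finsupp.single k.castSucc 1 + Finsupp.single j.succ 1 ≠
      Finsupp.single j.castSucc 1 + Finsupp.single k.succ 1 := by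
  intro h
  have := DFunLike.congr_fun h k.succ
  simp only [Finsupp.add_apply, Finsupp.single_apply, Fin.ext_iff, Fin.val_castSucc,
    Fin.val_succ] at this
  split_ifs at this <;> omega

theorem coeff_igMinor_self {m : ℕ} {j k : Fin m} (hjk : j < k) :
    coeff (Finsupp.single j.castSucc 1 + Finsupp.single k.succ 1) (igMinor m j k) =
      2 * (j : ℂ) + 1 := by
  classical
  rw [igMinor, C_mul_X_mul_X, C_mul_X_mul_X, coeff_sub, coeff_monomial, coeff_monomial, if_pos rfl,
    if_neg (single_add_single_ne hjk), sub_zero]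

theorem two_mul_natCast_add_one_ne_zero (n : ℕ) : 2 * (n : ℂ) + 1 ≠ 0 := by
  exact_mod_cast (by omega : 2 * n + 1 ≠ 0)

theorem igMinor_ne_zero {m : ℕ} {j k : Fin m} (hjk : j < k) : igMinor m j k ≠ 0 := by
  intro h
  have := coeff_igMinor_self hjk
  rw [h, coeff_zero] at this
  exact two_mul_natCast_add_one_ne_zero _ this.symm

/-- A minor has a positive coefficient only at its diagonal monomial, and that monomial determines
the two columns. -/
theorem igMinor_inj {m : ℕ} {j k j' k' : Fin m} (hjk : j < k) (hjk' : j' < k')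
    (h : igMinor m j k = igMinor m j' k') : j = j' ∧ k = k' := by
  classical
  have hc := coeff_igMinor_self hjk
  rw [h, igMinor, C_mul_X_mul_X, C_mul_X_mul_X, coeff_sub, coeff_monomial, coeff_monomial] at hc
  by_cases hs : Finsupp.single j'.castSucc 1 + Finsupp.single k'.succ 1 =
      Finsupp.single j.castSucc 1 + Finsupp.single k.succ 1
  · have h1 := DFunLike.congr_fun hs j.castSucc
    have h2 := DFunLike.congr_fun hs k.succ
    simp only [Finsupp.add_apply, Finsupp.single_apply, Fin.ext_iff, Fin.val_castSucc,
      Fin.val_succ] at h1 h2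
    constructor <;> apply Fin.ext <;> split_ifs at h1 h2 <;> omega
  · rw [if_neg hs] at hc
    exfalso
    split_ifs at hc
    · have : ((0 : ℕ) : ℂ) = ((2 * j + 1 + (2 * k' + 1) : ℕ) : ℂ) := by
        push_cast
        rw [← hc]
        ring
      have := Nat.cast_injective this
      omega
    · rw [sub_zero] at hc
      exact two_mul_natCast_add_one_ne_zero _ hc.symm

theorem minors_igCumulantMatrix_eq_image (m : ℕ) :
    minors 2 (igCumulantMatrix (m + 1)) =
      (fun p : (_ : Fin m) × Fin m => igMinor m p.2 p.1) ''
        (Finset.univ.sigma fun k : Fin m => Finset.Iio k : Finset ((_ : Fin m) × Fin m)) := by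
  rw [minors_igCumulantMatrix]
  ext f
  constructor
  · rintro ⟨j, k, hjk, rfl⟩
    exact ⟨⟨k, j⟩, by simpa using hjk, rfl⟩
  · rintro ⟨⟨k, j⟩, hjk, rfl⟩
    exact ⟨j, k, by simpa using hjk, rfl⟩

theorem ncard_minors_igCumulantMatrix (m : ℕ) :
    (minors 2 (igCumulantMatrix (m + 1))).ncard = m.choose 2 := by
  rw [minors_igCumulantMatrix_eq_image, Set.InjOn.ncard_image, Set.ncard_coe_finset,
    Finset.card_sigma]
  · simp only [Fin.card_Iio]
    rw [Fin.sum_univ_eq_sum_range (fun i => i), Finset.sum_range_id, Nat.choose_two_right]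
  · rintro ⟨k, j⟩ h ⟨k', j'⟩ h' hf
    obtain ⟨rfl, rfl⟩ := igMinor_inj (by simpa using h) (by simpa using h') hf
    rfl

/-! ### The cone over the rational normal curve -/

/-- The coordinates of a point divided by the scaling factors, extended by zero. -/
noncomputable def unscaled {d : ℕ} (x : Fin d → ℂ) (i : ℕ) : ℂ :=
  if h : i < d then (igScale i)⁻¹ * x ⟨i, h⟩ else 0

theorem aeval_igVar {d : ℕ} (x : Fin d → ℂ) (i : ℕ) : aeval x (igVar d i) = unscaled x i := by
  rw [igVar, unscaled]
  split_ifs <;> simp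

theorem eq_igScale_mul_unscaled {d : ℕ} (x : Fin d → ℂ) (i : Fin d) :
    x i = igScale i * unscaled x i := by
  rw [unscaled, dif_pos i.2, ← mul_assoc, mul_inv_cancel₀ (igScale_ne_zero _), one_mul]

theorem mem_igCumulantVariety_iff {m : ℕ} (hm : 1 ≤ m) (x : Fin (m + 1) → ℂ) :
    x ∈ igCumulantVariety (m + 1) ↔ IsRationalNormal m (unscaled x) := by
  have h : igCumulantVariety (m + 1) = zeroLocus ℂ (igIdeal m) := by
    rw [← vanishingIdeal_igCumulantVariety_eq_igIdeal hm, igCumulantVariety,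
      vanishingIdeal_zariskiClosure, zariskiClosure]
  rw [h, igIdeal, zeroLocus_span, minors_igCumulantMatrix]
  have hae : ∀ j k : Fin m, aeval x (igMinor m j k) = 0 ↔
      unscaled x j * unscaled x (k + 1) = unscaled x k * unscaled x (j + 1) := fun j k => by
    rw [igMinor_eq]
    simp only [map_mul, map_sub, aeval_igVar, algHom_C, Algebra.algebraMap_self, RingHom.id_apply]
    rw [mul_eq_zero, or_iff_right (mul_ne_zero (igScale_ne_zero _) (igScale_ne_zero _)),
      sub_eq_zero]
  constructor
  · intro hx j k hjk hk
    exact (hae ⟨j, hjk.trans hk⟩ ⟨k, hk⟩).1 (hx _ ⟨_, _, hjk, rfl⟩)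
  · rintro hx _ ⟨j, k, hjk, rfl⟩
    exact (hae j k).2 (hx j k hjk k.2)

theorem scaledCurvePoint_igScale {m : ℕ} (s t : ℂ) (i : Fin (m + 1)) :
    scaledCurvePoint (fun i : Fin (m + 1) => ((2 * (i : ℕ) - 1)‼ : ℂ)) s t i =
      igScale i * (s ^ (m - i) * t ^ (i : ℕ)) := by
  rw [scaledCurvePoint, igScale, mul_assoc, Nat.add_sub_cancel]

theorem igCumulantVariety_eq_affineCone {m : ℕ} (hm : 1 ≤ m) :
    igCumulantVariety (m + 1) = affineCone
      (scaledRationalNormalCurve fun i : Fin (m + 1) => ((2 * (i : ℕ) - 1)‼ : ℂ)) := by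
  ext x
  rw [mem_igCumulantVariety_iff hm]
  constructor
  · intro h hx
    suffices H : ∃ a s t : ℂ, ∀ i : Fin (m + 1), unscaled x i = a * (s ^ (m - i) * t ^ (i : ℕ)) by
      obtain ⟨a, s, t, H⟩ := H
      have hxa : x = a • scaledCurvePoint (fun i : Fin (m + 1) => ((2 * (i : ℕ) - 1)‼ : ℂ)) s t := by
        ext i
        rw [eq_igScale_mul_unscaled x i, H i, Pi.smul_apply, scaledCurvePoint_igScale, smul_eq_mul]
        ring
      have hp : scaledCurvePoint (fun i : Fin (m + 1) => ((2 * (i : ℕ) - 1)‼ : ℂ)) s t ≠ 0 := by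
        intro h0
        rw [h0, smul_zero] at hxa
        exact hx hxa
      exact ⟨s, t, hp, (Projectivization.mk_eq_mk_iff' _ _ _ _ _).2 ⟨a, hxa.symm⟩⟩
    -- If `y 0 = 0`, the equations `y i * y (i+2) = y (i+1) ^ 2` kill everything but `y m`, giving
    -- the point `[0 : 1]`. Otherwise the `y i` form a geometric progression of ratio `y 1 / y 0`.
    by_cases h0 : unscaled x 0 = 0
    · refine ⟨unscaled x m, 0, 1, fun i => ?_⟩
      have hz : ∀ i, i < m → unscaled x i = 0 := by
        intro i
        induction i with
        | zero => exact fun _ => h0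
        | succ i ih =>
          intro hi
          have := h i (i + 1) (by omega) hi
          rw [ih (by omega), zero_mul] at this
          exact mul_self_eq_zero.1 this.symm
      rcases (Nat.lt_succ_iff.1 i.2).eq_or_lt with hi | hi
      · rw [hi]; simp
      · rw [hz _ hi, zero_pow (by omega)]; simp
    · refine ⟨unscaled x 0, 1, unscaled x 1 / unscaled x 0, fun i => ?_⟩
      have hz : ∀ i, i ≤ m → unscaled x i = unscaled x 0 * (unscaled x 1 / unscaled x 0) ^ i := by
        intro i
        induction i with
        | zero => simp
        | succ i ih =>
          intro hi
          have hs : unscaled x 0 * unscaled x (i + 1) = unscaled x i * unscaled x 1 := by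
            rcases Nat.eq_zero_or_pos i with rfl | hi0
            · simp
            · exact h 0 i hi0 hi
          refine mul_left_cancel₀ h0 ?_
          rw [hs, ih (by omega), pow_succ]
          field_simp
      rw [hz i (Nat.lt_succ_iff.1 i.2), one_pow, one_mul]
  · intro h
    obtain ⟨a, s, t, H⟩ : ∃ a s t : ℂ, ∀ i, i ≤ m → unscaled x i = a * (s ^ (m - i) * t ^ i) := by
      -- The origin lies in the cone by convention and corresponds to `a = 0`.
      by_cases hx : x = 0
      · refine ⟨0, 0, 0, fun i hi => ?_⟩
        rw [unscaled, hx]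
        simp
      · obtain ⟨s, t, hp, he⟩ := h hx
        obtain ⟨a, ha⟩ := (Projectivization.mk_eq_mk_iff' _ _ _ _ _).1 he
        refine ⟨a, s, t, fun i hi => ?_⟩
        refine mul_left_cancel₀ (igScale_ne_zero i) ?_
        rw [← eq_igScale_mul_unscaled x ⟨i, Nat.lt_succ_of_le hi⟩, ← ha, Pi.smul_apply,
          scaledCurvePoint_igScale, smul_eq_mul]
        ring
    intro j k hjk hk
    rw [H j (by omega), H k (by omega), H (j + 1) (by omega), H (k + 1) (by omega)]
    have e : s ^ (m - j) * s ^ (m - (k + 1)) = s ^ (m - k) * s ^ (m - (j + 1)) := by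
      rw [← pow_add, ← pow_add]
      congr 1
      omega
    linear_combination a ^ 2 * t ^ (j + k + 1) * e

/-! ### Images of monomials under the parametrization -/

/-- The exponent of the image of the monomial with exponent `s`. -/
noncomputable def toricDegree {d : ℕ} (s : Fin d →₀ ℕ) : Fin 2 →₀ ℕ :=
  toricExponent s.degree (∑ i : Fin d, s i * (i : ℕ))

/-- The coefficient of the image of the monomial with exponent `s`. -/
noncomputable def toricCoeff {d : ℕ} (s : Fin d →₀ ℕ) : ℂ := ∏ i : Fin d, igScale i ^ s i

theorem toricCoeff_ne_zero {d : ℕ} (s : Fin d →₀ ℕ) : toricCoeff s ≠ 0 :=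
  Finset.prod_ne_zero_iff.2 fun _ _ => pow_ne_zero _ (igScale_ne_zero _)

theorem igToricMap_monomial {d : ℕ} (s : Fin d →₀ ℕ) (a : ℂ) :
    igToricMap d (monomial s a) = monomial (toricDegree s) (a * toricCoeff s) := by
  rw [igToricMap, aeval_monomial, Finsupp.prod_fintype _ _ (fun _ => pow_zero _), algebraMap_eq]
  simp only [mul_pow, toricSeq, Finset.prod_mul_distrib, ← pow_mul, Finset.prod_pow_eq_pow_sum,
    ← C_pow]
  rw [toricMonomial_eq, ← map_prod, ← mul_assoc, ← C_mul, C_mul_monomial, mul_one, toricDegree,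
    toricCoeff, Finsupp.degree_eq_sum]
  simp only [mul_comm]

/-- The exponent of the standard monomial with index `p`. -/
noncomputable def standardIndex (m : ℕ) (p : ℕ × Fin m × ℕ) : Fin (m + 1) →₀ ℕ :=
  Finsupp.single 0 p.1 + (if (p.2.1 : ℕ) = 0 then 0 else Finsupp.single p.2.1.castSucc 1) +
    Finsupp.single (Fin.last m) p.2.2

theorem sum_single_mul {d : ℕ} (i : Fin d) (n : ℕ) :
    ∑ j, (Finsupp.single i n) j * (j : ℕ) = n * i := by
  rw [Finset.sum_eq_single i] <;> simp +contextual [eq_comm]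

theorem toricDegree_standardIndex {m : ℕ} (p : ℕ × Fin m × ℕ) :
    toricDegree (standardIndex m p) = standardExponent m p := by
  rw [toricDegree, standardExponent, standardIndex, toricExponent_inj]
  simp only [Finsupp.add_apply, add_mul, Finset.sum_add_distrib, sum_single_mul, map_add,
    Finsupp.degree_single]
  split_ifs with h
  · simp [h, mul_comm]
  · simp only [sum_single_mul, Finsupp.degree_single, Fin.val_castSucc, Fin.val_last, Fin.val_zero]
    exact ⟨trivial, by ring⟩

/-- With `p = j + 1` and `q = k`, the excluded divisors are all products of two interior variables,
equal ones included. Hence at most one interior variable occurs, with exponent at most one. -/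
theorem exists_eq_standardIndex {m : ℕ} (hm : 1 ≤ m) {s : Fin (m + 1) →₀ ℕ}
    (hs : ∀ j k : Fin m, j < k →
      ¬ Finsupp.single k.castSucc 1 + Finsupp.single j.succ 1 ≤ s) :
    ∃ p, s = standardIndex m p := by
  have hlast : Fin.last m ≠ 0 := by
    rw [Ne, Fin.ext_iff]; simp; omega
  have hs' : ∀ p q : Fin (m + 1), 0 < (p : ℕ) → p ≤ q → (q : ℕ) < m →
      ¬ Finsupp.single q 1 + Finsupp.single p 1 ≤ s := by
    intro p q hp hpq hq
    have hpq' : (p : ℕ) ≤ q := hpq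
    have h := hs ⟨p - 1, by omega⟩ ⟨q, hq⟩ (by rw [Fin.lt_def]; simp only; omega)
    have e : Fin.succ ⟨(p : ℕ) - 1, by omega⟩ = p := Fin.ext (by simp only [Fin.val_succ]; omega)
    rwa [e] at h
  by_cases h : ∃ i : Fin (m + 1), 0 < (i : ℕ) ∧ (i : ℕ) < m ∧ s i ≠ 0
  · obtain ⟨i, hi0, him, hsi⟩ := h
    refine ⟨(s 0, ⟨i, him⟩, s (Fin.last m)), ?_⟩
    have hone : s i = 1 := by
      by_contra hne
      refine hs' i i hi0 le_rfl him ?_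
      rw [← Finsupp.single_add, Finsupp.single_le_iff]
      omega
    have hzero : ∀ n : Fin (m + 1), 0 < (n : ℕ) → (n : ℕ) < m → n ≠ i → s n = 0 := by
      intro n hn0 hnm hni
      by_contra hne
      have key : ∀ a b : Fin (m + 1), a ≠ b → s a ≠ 0 → s b ≠ 0 →
          Finsupp.single a 1 + Finsupp.single b 1 ≤ s := by
        intro a b hab ha hb c
        simp only [Finsupp.add_apply, Finsupp.single_apply]
        split_ifs with h1 h2 h2
        · exact absurd (h1.trans h2.symm) hab
        · subst h1; omega
        · subst h2; omega
        · omega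
      rcases le_total i n with hin | hin
      · exact hs' i n hi0 hin hnm (key n i hni hne hsi)
      · exact hs' n i hn0 hin him (key i n hni.symm hsi hne)
    ext n
    simp only [standardIndex, hi0.ne', if_false, Finsupp.add_apply, Finsupp.single_apply,
      Fin.castSucc_mk, Fin.eta]
    by_cases h0 : (0 : Fin (m + 1)) = n
    · subst h0
      have h1 : i ≠ 0 := by rintro rfl; simp at hi0
      simp [h1, hlast]
    by_cases h1 : i = n
    · subst h1
      have h2 : Fin.last m ≠ i := by rintro rfl; simp at him
      simp [h0, h2, hone]
    by_cases h2 : Fin.last m = n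
    · subst h2
      simp [h0, h1]
    · simp only [h0, h1, h2, if_false]
      refine hzero n ?_ ?_ (Ne.symm h1)
      · rw [Fin.ext_iff] at h0; simp at h0; omega
      · rw [Fin.ext_iff] at h2; simp at h2; omega
  · push Not at h
    refine ⟨(s 0, ⟨0, hm⟩, s (Fin.last m)), ?_⟩
    ext n
    simp only [standardIndex, if_true, Finsupp.add_apply, Finsupp.single_apply, Finsupp.zero_apply]
    by_cases h0 : (0 : Fin (m + 1)) = n
    · subst h0
      simp [hlast]
    by_cases h2 : Fin.last m = n
    · subst h2
      simp [h0]
    · simp only [h0, h2, if_false]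
      refine h n ?_ ?_
      · rw [Fin.ext_iff] at h0; simp at h0; omega
      · rw [Fin.ext_iff] at h2; simp at h2; omega

/-- A polynomial in the kernel all of whose monomials are standard is zero. -/
theorem eq_zero_of_igToricMap_eq_zero {m : ℕ} {r : MvPolynomial (Fin (m + 1)) ℂ}
    (hr : ∀ s ∈ r.support, ∃ p, s = standardIndex m p) (h : igToricMap (m + 1) r = 0) : r = 0 := by
  classical
  by_contra hne
  obtain ⟨s, hs⟩ := Finset.nonempty_iff_ne_empty.2 (mt support_eq_empty.1 hne)
  rw [r.as_sum, map_sum] at h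
  have hc := congrArg (coeff (toricDegree s)) h
  simp only [coeff_sum, igToricMap_monomial, coeff_monomial, coeff_zero] at hc
  -- Distinct standard monomials have distinct images, so no other term of `r` reaches this
  -- coefficient.
  rw [Finset.sum_eq_single s, if_pos rfl] at hc
  · exact mul_ne_zero (mem_support_iff.1 hs) (toricCoeff_ne_zero s) hc
  · intro t ht hts
    refine if_neg fun he => hts ?_
    obtain ⟨p, rfl⟩ := hr s hs
    obtain ⟨q, rfl⟩ := hr t ht
    rw [toricDegree_standardIndex, toricDegree_standardIndex] at he
    rw [standardExponent_injective m he]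
  · exact fun h => absurd hs h

/-! ### Gröbner basis -/

theorem degree_igMinor {m : ℕ} {o : MonomialOrder (Fin (m + 1))}
    (ho : IsAntidiagonal o (igCumulantMatrix (m + 1))) {j k : Fin m} (hjk : j < k) :
    o.degree (igMinor m j k) = Finsupp.single k.castSucc 1 + Finsupp.single j.succ 1 := by
  classical
  have hc := strictMono_pair hjk
  have h := ho 2 (RelEmbedding.refl _) (OrderEmbedding.ofStrictMono ![j, k] hc)
  have hl : ((igCumulantMatrix (m + 1)).submatrix (RelEmbedding.refl (α := Fin 2) (· ≤ ·))
      (OrderEmbedding.ofStrictMono ![j, k] hc)).det = igMinor m j k := by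
    rw [Matrix.det_fin_two]
    rfl
  have hr : ∏ i : Fin 2, igCumulantMatrix (m + 1) ((RelEmbedding.refl (α := Fin 2) (· ≤ ·)) i)
      ((OrderEmbedding.ofStrictMono ![j, k] hc) i.rev) =
        C (2 * (k : ℂ) + 1) * X k.castSucc * X j.succ := by
    rw [Fin.prod_univ_two]
    rfl
  have h' := (congrArg o.degree hl).symm.trans (h.trans (congrArg o.degree hr))
  rw [h', C_mul_X_mul_X, o.degree_monomial, if_neg (two_mul_natCast_add_one_ne_zero _)]

theorem isGroebnerBasis_minors {m : ℕ} (hm : 1 ≤ m) (o : MonomialOrder (Fin (m + 1)))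
    (ho : IsAntidiagonal o (igCumulantMatrix (m + 1))) :
    IsGroebnerBasis o (minors 2 (igCumulantMatrix (m + 1))) (igIdeal m) := by
  classical
  refine ⟨?_, Ideal.subset_span, le_antisymm
    (Ideal.span_mono (Set.image_mono Ideal.subset_span)) (Ideal.span_le.2 ?_)⟩
  · rw [minors_igCumulantMatrix_eq_image]
    exact (Finset.finite_toSet _).image _
  rintro _ ⟨f, hf, rfl⟩
  by_cases hf0 : f = 0
  · rw [hf0, o.leadingTerm_zero]; exact zero_mem _
  have hne : ∀ b ∈ minors 2 (igCumulantMatrix (m + 1)), b ≠ 0 := by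
    rw [minors_igCumulantMatrix]
    rintro _ ⟨j, k, hjk, rfl⟩
    exact igMinor_ne_zero hjk
  obtain ⟨g, r, hfr, hdeg, hr⟩ := o.div_set (B := minors 2 (igCumulantMatrix (m + 1)))
    (fun b hb => isUnit_iff_ne_zero.2 (o.leadingCoeff_ne_zero_iff.2 (hne b hb))) f
  rw [Finsupp.linearCombination_apply, Finsupp.sum] at hfr
  have hsum : ∑ b ∈ g.support, g b • (b : MvPolynomial (Fin (m + 1)) ℂ) ∈ igIdeal m :=
    sum_mem fun b _ => Ideal.mul_mem_left _ _ (Ideal.subset_span b.2)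
  have hr0 : r = 0 := by
    refine eq_zero_of_igToricMap_eq_zero (fun s hs => exists_eq_standardIndex hm fun j k hjk => ?_)
      (igIdeal_le_ker m ?_)
    · rw [← degree_igMinor ho hjk]
      refine hr s hs _ ?_
      rw [minors_igCumulantMatrix]
      exact ⟨j, k, hjk, rfl⟩
    · have : r = f - ∑ b ∈ g.support, g b • (b : MvPolynomial (Fin (m + 1)) ℂ) := by
        rw [hfr]; ring
      rw [this]
      exact sub_mem hf hsum
  rw [hr0, add_zero] at hfr
  have hsupp : g.support.Nonempty := by
    rw [Finset.nonempty_iff_ne_empty]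
    rintro h
    rw [h, Finset.sum_empty] at hfr
    exact hf0 hfr
  -- Division bounds the degree of each summand by that of `f`, so the summand of largest degree
  -- attains it; its minor has a leading monomial dividing that of `f`.
  obtain ⟨b, hb, hsup⟩ := Finset.exists_mem_eq_sup g.support hsupp
    fun b => o.toSyn (o.degree (g b • (b : MvPolynomial (Fin (m + 1)) ℂ)))
  have hle := o.degree_sum_le (s := g.support)
    (f := fun b => g b • (b : MvPolynomial (Fin (m + 1)) ℂ))
  rw [← hfr, hsup] at hle
  have heq : o.degree f = o.degree (b : MvPolynomial (Fin (m + 1)) ℂ) + o.degree (g b) := by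
    rw [← o.degree_mul (hne b b.2) (Finsupp.mem_support_iff.1 hb)]
    refine o.toSyn.injective (le_antisymm ?_ (hdeg b))
    rwa [smul_eq_mul, mul_comm] at hle
  have hlc : o.leadingCoeff (b : MvPolynomial (Fin (m + 1)) ℂ) ≠ 0 :=
    o.leadingCoeff_ne_zero_iff.2 (hne b b.2)
  have : o.leadingTerm f =
      monomial (o.degree (g b)) (o.leadingCoeff f / o.leadingCoeff (b : MvPolynomial _ ℂ)) *
        o.leadingTerm (b : MvPolynomial _ ℂ) := by
    rw [MonomialOrder.leadingTerm, MonomialOrder.leadingTerm, monomial_mul,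
      heq.trans (add_comm _ _), div_mul_cancel₀ _ hlc]
  rw [SetLike.mem_coe, this]
  exact Ideal.mul_mem_left _ _ (Ideal.subset_span ⟨b, b.2, rfl⟩)

/-! ### Hilbert function and degree -/

theorem map_homogeneousSubmodule_igToricMap {m : ℕ} (hm : 1 ≤ m) (n : ℕ) :
    (homogeneousSubmodule (Fin (m + 1)) ℂ n).map (igToricMap (m + 1)).toLinearMap =
      Submodule.span ℂ (Set.range fun e : Fin (n * m + 1) =>
        (monomial (toricExponent n e) 1 : MvPolynomial (Fin 2) ℂ)) := by
  apply le_antisymm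
  · rintro _ ⟨f, hf, rfl⟩
    rw [f.as_sum, map_sum]
    refine sum_mem fun s hs => ?_
    have hd : s.degree = n := by
      rw [Finsupp.degree_eq_weight_one]
      exact hf (mem_support_iff.1 hs)
    have hle : ∑ i, s i * (i : ℕ) ≤ n * m := by
      rw [← hd, Finsupp.degree_eq_sum, Finset.sum_mul]
      exact Finset.sum_le_sum fun i _ => Nat.mul_le_mul_left _ (Nat.lt_succ_iff.1 i.2)
    have hsm : (monomial (toricDegree s) (coeff s f * toricCoeff s) : MvPolynomial (Fin 2) ℂ) =
        (coeff s f * toricCoeff s) • monomial (toricDegree s) 1 := by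
      rw [smul_monomial, smul_eq_mul, mul_one]
    rw [AlgHom.toLinearMap_apply, igToricMap_monomial, hsm]
    refine Submodule.smul_mem _ _ (Submodule.subset_span ⟨⟨_, Nat.lt_succ_of_le hle⟩, ?_⟩)
    simp only [toricDegree, hd]
  · rw [Submodule.span_le]
    rintro _ ⟨e, rfl⟩
    -- Divide `e` by `m`: the quotient is the power of `y m`, the remainder selects the interior
    -- variable, and `y 0` fills up the degree. A nonzero remainder forces the quotient below `n`,
    -- leaving room for that variable.
    obtain ⟨p, hp⟩ : ∃ p, standardExponent m p = toricExponent n e := by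
      have he : (e : ℕ) ≤ n * m := Nat.lt_succ_iff.1 e.2
      have hdm := Nat.div_add_mod (e : ℕ) m
      have hmod := Nat.mod_lt (e : ℕ) hm
      have hdiv : (e : ℕ) / m ≤ n := Nat.div_le_of_le_mul (he.trans_eq (mul_comm n m))
      by_cases h0 : (e : ℕ) % m = 0
      · refine ⟨(n - e / m, ⟨0, hm⟩, e / m), ?_⟩
        rw [standardExponent, toricExponent_inj]
        simp only [if_true]
        omega
      · refine ⟨(n - e / m - 1, ⟨e % m, hmod⟩, e / m), ?_⟩
        have hlt : (e : ℕ) / m < n := by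
          refine Nat.lt_of_mul_lt_mul_left (a := m) ?_
          rw [mul_comm m n]
          omega
        rw [standardExponent, toricExponent_inj]
        simp only [h0, if_false]
        omega
    rw [← toricDegree_standardIndex] at hp
    have hdeg : (standardIndex m p).degree = n := (toricExponent_inj.1 hp).1
    refine ⟨monomial (standardIndex m p) (toricCoeff (standardIndex m p))⁻¹,
      isHomogeneous_monomial _ hdeg, ?_⟩
    rw [AlgHom.toLinearMap_apply, igToricMap_monomial, hp,
      inv_mul_cancel₀ (toricCoeff_ne_zero _)]

theorem hilbertFunction_igIdeal {m : ℕ} (hm : 1 ≤ m) (n : ℕ) :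
    hilbertFunction (igIdeal m) n = n * m + 1 := by
  have hinj : Function.Injective (igQuotientMap m).toLinearMap := igQuotientMap_injective hm
  rw [hilbertFunction, (Submodule.equivMapOfInjective _ hinj _).finrank_eq]
  have hcomp : (igQuotientMap m).toLinearMap ∘ₗ (Ideal.Quotient.mkₐ ℂ (igIdeal m)).toLinearMap =
      (igToricMap (m + 1)).toLinearMap := rfl
  rw [← Submodule.map_comp, hcomp, map_homogeneousSubmodule_igToricMap hm, finrank_span_eq_card,
    Fintype.card_fin]
  have hi : Function.Injective fun e : Fin (n * m + 1) => toricExponent n e := fun a b hab =>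
    Fin.ext (toricExponent_inj.1 hab).2
  have h := (basisMonomials (Fin 2) ℂ).linearIndependent.comp _ hi
  rwa [coe_basisMonomials] at h

theorem hasDegree_igIdeal {m : ℕ} (hm : 1 ≤ m) : HasDegree (igIdeal m) m := by
  have hm0 : (m : ℚ) ≠ 0 := Nat.cast_ne_zero.2 (by omega)
  refine ⟨Polynomial.C (m : ℚ) * Polynomial.X + Polynomial.C 1, ?_, ?_, ?_⟩
  · intro h
    have := congrArg Polynomial.natDegree h
    rw [Polynomial.natDegree_linear hm0] at this
    simp at this
  · refine Eventually.of_forall fun n => ?_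
    rw [hilbertFunction_igIdeal hm]
    simp [mul_comm]
  · rw [Polynomial.leadingCoeff_linear hm0, Polynomial.natDegree_linear hm0]
    simp

/-! ### Finite free extensions of a polynomial ring are Cohen–Macaulay -/

theorem prime_X_zero_sub_C (a : ℂ) : Prime (X 0 - C a : MvPolynomial (Fin 2) ℂ) := by
  rw [← MulEquiv.prime_iff (finSuccEquiv ℂ 1).toMulEquiv]
  have h : (finSuccEquiv ℂ 1).toMulEquiv (X 0 - C a) = Polynomial.X - Polynomial.C (C a) := by
    change finSuccEquiv ℂ 1 (X 0 - C a) = _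
    rw [map_sub, finSuccEquiv_X_zero]
    congr 1
    exact (finSuccEquiv ℂ 1).commutes a
  rw [h]
  exact Polynomial.prime_X_sub_C _

theorem isWeaklyRegular_X_sub_C (x : Fin 2 → ℂ) :
    RingTheory.Sequence.IsWeaklyRegular (MvPolynomial (Fin 2) ℂ)
      [(X 0 - C (x 0) : MvPolynomial (Fin 2) ℂ), X 1 - C (x 1)] := by
  have hp := prime_X_zero_sub_C (x 0)
  rw [RingTheory.Sequence.isWeaklyRegular_cons_iff,
    RingTheory.Sequence.isWeaklyRegular_singleton_iff]
  constructor
  · intro f g hfg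
    exact mul_left_cancel₀ hp.ne_zero hfg
  · rw [isSMulRegular_iff_right_eq_zero_of_smul]
    intro f
    induction f using Submodule.Quotient.induction_on with
    | H f =>
    intro hf
    rw [← Submodule.Quotient.mk_smul, Submodule.Quotient.mk_eq_zero,
      Submodule.mem_smul_pointwise_iff_exists] at hf
    obtain ⟨g, -, hg⟩ := hf
    rw [Submodule.Quotient.mk_eq_zero, Submodule.mem_smul_pointwise_iff_exists]
    rw [smul_eq_mul, smul_eq_mul] at hg
    rcases hp.dvd_or_dvd (Dvd.intro _ hg) with ⟨q, hq⟩ | ⟨q, hq⟩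
    -- At this point `X 0 - C (x 0)` vanishes while `X 1 - C (x 1)` equals `1`.
    · have := congrArg (eval ![x 0, x 1 + 1]) hq
      simp at this
    · exact ⟨q, Submodule.mem_top, hq.symm⟩

/-- Modulo `P` the variables become constants, so the quotient map factors through evaluation at
`x`, and `P` contains the maximal ideal of that point. -/
theorem isMaximal_of_X_sub_C_mem {P : Ideal (MvPolynomial (Fin 2) ℂ)} [P.IsPrime] {x : Fin 2 → ℂ}
    (h : ∀ i, X i - C (x i) ∈ P) : P.IsMaximal := by
  have hle : vanishingIdeal ℂ {x} ≤ P := by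
    intro f hf
    have he : Ideal.Quotient.mkₐ ℂ P =
        (Algebra.ofId ℂ (MvPolynomial (Fin 2) ℂ ⧸ P)).comp (aeval x) := by
      ext i
      rw [AlgHom.comp_apply, aeval_X]
      exact Ideal.Quotient.eq.2 (h i)
    have h0 := DFunLike.congr_fun he f
    rw [AlgHom.comp_apply, (mem_vanishingIdeal_singleton_iff x f).1 hf, map_zero] at h0
    exact Ideal.Quotient.eq_zero_iff_mem.1 h0
  have hmax : (vanishingIdeal ℂ {x} : Ideal (MvPolynomial (Fin 2) ℂ)).IsMaximal := inferInstance
  exact hmax.eq_of_le (Ideal.IsPrime.ne_top ‹_›) hle ▸ hmax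

/-- A maximal ideal of `R` lies over a point `x` of the plane, by integrality and the
Nullstellensatz. The sequence `X i - x i` stays weakly regular in `R` by flatness and becomes
regular in the localization. It has length equal to the dimension because the local ring modulo it
has dimension zero. -/
theorem isCohenMacaulay_of_finite_free (R : Type*) [CommRing R] [Algebra (MvPolynomial (Fin 2) ℂ) R]
    [Module.Finite (MvPolynomial (Fin 2) ℂ) R] [Module.Free (MvPolynomial (Fin 2) ℂ) R] :
    IsCohenMacaulay R := by
  have hN : IsNoetherianRing R := IsNoetherianRing.of_finite (MvPolynomial (Fin 2) ℂ) R
  refine ⟨hN, fun p hp => ?_⟩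
  have hNL : IsNoetherianRing (Localization.AtPrime p) :=
    IsLocalization.isNoetherianRing p.primeCompl _ hN
  have hq : (p.comap (algebraMap (MvPolynomial (Fin 2) ℂ) R)).IsMaximal :=
    Ideal.isMaximal_comap_of_isIntegral_of_isMaximal p
  obtain ⟨x, hx⟩ := isMaximal_iff_eq_vanishingIdeal_singleton.1 hq
  have hmem : ∀ i, algebraMap (MvPolynomial (Fin 2) ℂ) R (X i - C (x i)) ∈ p := by
    intro i
    rw [← Ideal.mem_comap, hx, mem_vanishingIdeal_singleton_iff]
    simp
  set rs : List R := [(X 0 - C (x 0) : MvPolynomial (Fin 2) ℂ), X 1 - C (x 1)].map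
    (algebraMap (MvPolynomial (Fin 2) ℂ) R) with hrs
  have hwr : RingTheory.Sequence.IsWeaklyRegular R rs := (isWeaklyRegular_X_sub_C x).of_flat
  have hrsmem : ∀ r ∈ rs, r ∈ p := by
    intro r hr
    simp only [hrs, List.map_cons, List.map_nil, List.mem_cons, List.not_mem_nil, or_false] at hr
    rcases hr with rfl | rfl
    exacts [hmem 0, hmem 1]
  have hreg := hwr.isRegular_of_isLocalization_of_mem (Localization.AtPrime p) p hrsmem
  set ts := rs.map (algebraMap R (Localization.AtPrime p)) with hts
  have htmem : ∀ r ∈ ts, r ∈ IsLocalRing.maximalIdeal (Localization.AtPrime p) := by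
    intro r hr
    obtain ⟨s, hs, rfl⟩ := List.mem_map.1 hr
    exact (IsLocalization.AtPrime.to_map_mem_maximal_iff _ p s).2 (hrsmem s hs)
  refine ⟨hNL, ts, htmem, hreg, ?_⟩
  have hdim := ringKrullDim_add_length_eq_ringKrullDim_of_isRegular ts hreg
  have hzero : ringKrullDim (Localization.AtPrime p ⧸ Ideal.ofList ts) = 0 := by
    have hnt : Nontrivial (Localization.AtPrime p ⧸ Ideal.ofList ts) := by
      refine Ideal.Quotient.nontrivial_iff.2 fun h => ?_
      refine (IsLocalRing.maximalIdeal.isMaximal (Localization.AtPrime p)).ne_top ?_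
      rw [eq_top_iff, ← h]
      exact Ideal.span_le.2 htmem
    -- Pull a prime `J` back to the plane: there it contains every `X i - x i`, so it is maximal.
    -- Integrality lifts maximality to `J2`, which lies in `p` and so equals it; hence `J1` is the
    -- maximal ideal.
    refine (ringKrullDimZero_iff_ringKrullDim_eq_zero).1 (Ring.KrullDimLE.mk₀ fun J hJ => ?_)
    have hJ1 : (J.comap (Ideal.Quotient.mk (Ideal.ofList ts))).IsPrime := Ideal.comap_isPrime _ _
    set J1 := J.comap (Ideal.Quotient.mk (Ideal.ofList ts)) with hJ1def
    have hJ2 : (J1.comap (algebraMap R (Localization.AtPrime p))).IsPrime :=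
      Ideal.comap_isPrime _ _
    set J2 := J1.comap (algebraMap R (Localization.AtPrime p)) with hJ2def
    have hJ3 : (J2.comap (algebraMap (MvPolynomial (Fin 2) ℂ) R)).IsPrime :=
      Ideal.comap_isPrime _ _
    have htJ : ∀ r ∈ ts, r ∈ J1 := by
      intro r hr
      have h0 : Ideal.Quotient.mk (Ideal.ofList ts) r = 0 :=
        Ideal.Quotient.eq_zero_iff_mem.2 (Ideal.subset_span hr)
      rw [hJ1def, Ideal.mem_comap, h0]
      exact J.zero_mem
    have hJ3max : (J2.comap (algebraMap (MvPolynomial (Fin 2) ℂ) R)).IsMaximal := by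
      refine isMaximal_of_X_sub_C_mem (x := x) fun i => ?_
      rw [Ideal.mem_comap, hJ2def, Ideal.mem_comap]
      refine htJ _ (List.mem_map_of_mem (List.mem_map_of_mem ?_))
      fin_cases i <;> simp
    have hJ2max : J2.IsMaximal := Ideal.isMaximal_of_isIntegral_of_isMaximal_comap J2 hJ3max
    have hJ1le : J1 ≤ IsLocalRing.maximalIdeal _ := IsLocalRing.le_maximalIdeal hJ1.ne_top
    have hJ2p : J2 = p := hJ2max.eq_of_le hp.ne_top fun r hr =>
      (IsLocalization.AtPrime.to_map_mem_maximal_iff (Localization.AtPrime p) p r).1 (hJ1le hr)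
    have hJ1max : J1 = IsLocalRing.maximalIdeal _ := by
      have h := IsLocalization.map_under p.primeCompl (Localization.AtPrime p) J1
      rw [show Ideal.under R J1 = p from hJ2p] at h
      rw [← h]
      exact Localization.AtPrime.map_eq_maximalIdeal
    have : J1.IsMaximal := hJ1max ▸ IsLocalRing.maximalIdeal.isMaximal _
    have hor := Ideal.map_eq_top_or_isMaximal_of_surjective (Ideal.Quotient.mk (Ideal.ofList ts))
      Ideal.Quotient.mk_surjective this
    rw [Ideal.map_comap_of_surjective _ Ideal.Quotient.mk_surjective] at hor
    exact hor.resolve_left hJ.ne_top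
  rw [hzero, zero_add] at hdim
  exact hdim

/-! ### The coordinate ring is Cohen–Macaulay -/

/-- The map `ℂ[x, y] → ℂ[A, B]` with `x ↦ A` and `y ↦ A * B ^ m`. -/
noncomputable def noetherMap (m : ℕ) : MvPolynomial (Fin 2) ℂ →ₐ[ℂ] MvPolynomial (Fin 2) ℂ :=
  aeval ![toricSeq 0, toricSeq m]

theorem noetherMap_monomial_mul {m : ℕ} (s : Fin 2 →₀ ℕ) (a : ℂ) (i : Fin m) :
    noetherMap m (monomial s a) * middleFactor toricSeq i =
      monomial (standardExponent m (s 0, i, s 1)) a := by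
  have h : noetherMap m (monomial s a) = C a * (toricSeq 0 ^ s 0 * toricSeq m ^ s 1) := by
    rw [noetherMap, aeval_monomial, Finsupp.prod_fintype _ _ (fun _ => pow_zero _),
      Fin.prod_univ_two, algebraMap_eq]
    rfl
  have h' := standardMonomial_toricSeq m (s 0, i, s 1)
  rw [standardMonomial] at h'
  rw [h, ← mul_one a, ← C_mul_monomial, ← h', mul_one]
  ring

/-- By injectivity of the standard exponents, the monomials contributed by different `i` never
overlap. Every coefficient of a `ℂ[x, y]`-linear combination can thus be read off, which gives
linear independence. -/
theorem coeff_noetherMap_mul {m : ℕ} (f : MvPolynomial (Fin 2) ℂ) (i j : Fin m) (t : Fin 2 →₀ ℕ) :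
    coeff (standardExponent m (t 0, j, t 1)) (noetherMap m f * middleFactor toricSeq i) =
      if i = j then coeff t f else 0 := by
  classical
  induction f using MvPolynomial.induction_on' with
  | monomial s a =>
    rw [noetherMap_monomial_mul, coeff_monomial, coeff_monomial]
    have : standardExponent m (s 0, i, s 1) = standardExponent m (t 0, j, t 1) ↔ i = j ∧ s = t := by
      rw [(standardExponent_injective m).eq_iff, Prod.mk.injEq, Prod.mk.injEq]
      constructor
      · rintro ⟨h0, h, h1⟩
        refine ⟨h, Finsupp.ext fun n => ?_⟩
        fin_cases n
        exacts [h0, h1]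
      · rintro ⟨h, rfl⟩
        exact ⟨rfl, h, rfl⟩
    simp only [this, ite_and]
  | add f g hf hg =>
    rw [map_add, add_mul, coeff_add, hf, hg]
    split_ifs <;> simp

theorem isCohenMacaulay_of_span_standardMonomial {R : Type*} [CommRing R] [Algebra ℂ R] {m : ℕ}
    {y : ℕ → R} (Φ : R →ₐ[ℂ] MvPolynomial (Fin 2) ℂ) (hΦ : ∀ i ≤ m, Φ (y i) = toricSeq i)
    (hy : Submodule.span ℂ (Set.range (standardMonomial m y)) = ⊤) : IsCohenMacaulay R := by
  -- Noether normalization by the two end variables; the factors `1, y 1, …, y (m-1)` will be a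
  -- basis over it.
  let ψ : MvPolynomial (Fin 2) ℂ →ₐ[ℂ] R := aeval ![y 0, y m]
  let _ : Algebra (MvPolynomial (Fin 2) ℂ) R := ψ.toRingHom.toAlgebra
  have hsmul : ∀ (f : MvPolynomial (Fin 2) ℂ) (r : R), f • r = ψ f * r := fun _ _ => rfl
  have hcomp : ∀ f, Φ (ψ f) = noetherMap m f := by
    intro f
    have : Φ.comp ψ = noetherMap m := by
      ext1 i
      rw [AlgHom.comp_apply, aeval_X, noetherMap, aeval_X]
      fin_cases i
      · exact hΦ 0 (Nat.zero_le m)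
      · exact hΦ m le_rfl
    exact DFunLike.congr_fun this f
  let w : Fin m → R := fun i => middleFactor y i
  have hw : ∀ i, Φ (w i) = middleFactor toricSeq i := by
    intro i
    simp only [w, middleFactor, apply_ite Φ, map_one,
      hΦ i i.2.le]
  have hli : LinearIndependent (MvPolynomial (Fin 2) ℂ) w := by
    rw [Fintype.linearIndependent_iff]
    intro f hf j
    ext t
    have h := congrArg (fun r => coeff (standardExponent m (t 0, j, t 1)) (Φ r)) hf
    simp only [hsmul, map_sum, map_mul, hcomp, hw, coeff_sum, coeff_noetherMap_mul, map_zero,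
      coeff_zero, Finset.sum_ite_eq', Finset.mem_univ, if_true] at h
    rw [h, coeff_zero]
  have hspan : ⊤ ≤ Submodule.span (MvPolynomial (Fin 2) ℂ) (Set.range w) := by
    intro r _
    have hr : r ∈ Submodule.span ℂ (Set.range (standardMonomial m y)) :=
      hy ▸ Submodule.mem_top
    induction hr using Submodule.span_induction with
    | mem r hr =>
      obtain ⟨⟨k, i, b⟩, rfl⟩ := hr
      have : standardMonomial m y (k, i, b) =
          (X 0 ^ k * X 1 ^ b : MvPolynomial (Fin 2) ℂ) • w i := by
        rw [hsmul, map_mul, map_pow, map_pow, aeval_X, aeval_X, standardMonomial]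
        simp only [w, Matrix.cons_val_zero, Matrix.cons_val_one]
        ring
      rw [this]
      exact Submodule.smul_mem _ _ (Submodule.subset_span ⟨i, rfl⟩)
    | zero => exact zero_mem _
    | add r s _ _ hr hs => exact add_mem (hr trivial) (hs trivial)
    | smul a r _ hr =>
      have : a • r = (C a : MvPolynomial (Fin 2) ℂ) • r := by
        rw [hsmul, algHom_C, Algebra.smul_def]
      rw [this]
      exact Submodule.smul_mem _ _ (hr trivial)
  let B := Module.Basis.mk hli hspan
  have := Module.Free.of_basis B
  have := Module.Finite.of_basis B
  exact isCohenMacaulay_of_finite_free R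

theorem isCohenMacaulay_igQuotient {m : ℕ} (hm : 1 ≤ m) :
    IsCohenMacaulay (MvPolynomial (Fin (m + 1)) ℂ ⧸ igIdeal m) :=
  isCohenMacaulay_of_span_standardMonomial (igQuotientMap m)
    (fun _ hi => igQuotientMap_igClass hi) (span_standardMonomial_igClass hm)

/-! ### The main theorem -/

theorem mainTheorem9 (d : ℕ) (hd : 2 ≤ d) :
    -- the parametrization consists of the cumulants of the inverse Gaussian distribution
    (∀ μ lam : ℝ, 0 < μ → 0 < lam → IsProbabilityMeasure (inverseGaussian μ lam) ∧
      ∀ r : ℕ, 1 ≤ r → (cumulant (inverseGaussian μ lam) r : ℂ) = igCumulant μ lam r) ∧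
    -- the ideal is prime and generated by the `2`-minors, which are `(d-1).choose 2` quadrics
    (vanishingIdeal ℂ (igCumulantVariety d)).IsPrime ∧
    vanishingIdeal ℂ (igCumulantVariety d) = Ideal.span (minors 2 (igCumulantMatrix d)) ∧
    (minors 2 (igCumulantMatrix d)).ncard = (d - 1).choose 2 ∧
    (∀ f ∈ minors 2 (igCumulantMatrix d), f ≠ 0 ∧ f.IsHomogeneous 2) ∧
    -- it is Cohen–Macaulay of degree `d-1`
    IsCohenMacaulay (MvPolynomial (Fin d) ℂ ⧸ vanishingIdeal ℂ (igCumulantVariety d)) ∧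
    HasDegree (vanishingIdeal ℂ (igCumulantVariety d)) (d - 1) ∧
    -- the minors are a Gröbner basis for every antidiagonal term order
    (∀ m : MonomialOrder.{0, u} (Fin d), IsAntidiagonal m (igCumulantMatrix d) →
      IsGroebnerBasis m (minors 2 (igCumulantMatrix d))
        (vanishingIdeal ℂ (igCumulantVariety d))) ∧
    -- the variety is the cone over a scaled rational normal curve
    igCumulantVariety d =
      affineCone (scaledRationalNormalCurve fun i : Fin d => ((2 * (i : ℕ) - 1)‼ : ℂ)) := by
  obtain ⟨m, rfl⟩ : ∃ m, d = m + 1 := ⟨d - 1, by omega⟩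
  have hm : 1 ≤ m := by omega
  have hI := vanishingIdeal_igCumulantVariety_eq_igIdeal hm
  rw [hI]
  refine ⟨fun μ lam hμ hl => ⟨isProbabilityMeasure_inverseGaussian hμ hl,
    fun r hr => cumulant_inverseGaussian hμ hl hr⟩, igIdeal_isPrime hm, rfl,
    ncard_minors_igCumulantMatrix m, ?_, isCohenMacaulay_igQuotient hm, hasDegree_igIdeal hm,
    fun o ho => isGroebnerBasis_minors hm o ho, igCumulantVariety_eq_affineCone hm⟩
  rw [minors_igCumulantMatrix]
  rintro _ ⟨j, k, hjk, rfl⟩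
  exact ⟨igMinor_ne_zero hjk, isHomogeneous_igMinor m j k⟩
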